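/- Let $\mathcal N_n(\rho)=\sum_{u,v\in\mathbb Z_2^n}p_{u,v}\,X^uZ^v\rho Z^vX^u$ be an $n$-qubit Pauli channel ($p_{u,v}\ge 0$, $\sum_{u,v}p_{u,v}=1$), where $X^u|x\rangle=|x+u\rangle$ and $Z^v|x\rangle=(-1)^{x\cdot v}|x\rangle$. Let $C\subseteq\mathbb Z_2^n$ be an $[n,k]$ linear code with generator matrix $G$ ($n\times k$, column space $C$), parity check matrix $H$ ($(n-k)\times n$, null space $C$) and an inverse syndrome function $\hat u:\mathbb Z_2^{n-k}\to\mathbb Z_2^n$, $H\hat u(e)=e$. Put $p_u=\sum_v p_{u,v}$, $p_e=\sum_{u:Hu=e}p_u$, $p_{u|e}=I(Hu=e)\,p_u/p_e$, and let $\epsilon=\sum_e p_e\,(1-p_{\hat u(e)|e})$ be the average bit-flip decoding error (syndromes with $p_e=0$ contribute $0$). Let $f:\mathbb Z_2^k\to\mathbb Z_2^m$ be a random function that is two-universal, i.e. $\Pr[f(y)=f(y')]\le 2^{-m}$ for all $y\ne y'$, and each realization of which is affine, $f(y)=Ay+s_0$ with an $m\times k$ matrix $A$ of rank $m$. An $[[n,m]]$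 entanglement generation code consists of an encoding isometry $U:(\mathbb C^2)^{\otimes m}\to(\mathbb C^2)^{\otimes n}$ and a decoding operation $\mathcal D$ (a completely positive trace-preserving map from $n$-qubit to $m$-qubit operators). Its error on $\mathcal N_n$ is $$\big\|(\mathrm{id}_R\otimes \mathcal D\circ\mathcal N_n\circ U)(\Phi^{\otimes m})-\Phi^{\otimes m}\big\|_1,$$ where $\|M\|_1=\operatorname{tr}\sqrt{M^\dagger M}$, $U$ acts on operators by $\rho\mapsto U\rho U^\dagger$, and $\Phi^{\otimes m}$ is the projector onto $2^{-m/2}\sum_{s\in\mathbb Z_2^m}|s\rangle^R|s\rangle$. For a realization of $f$, the code is a P-CSS code (for $G,H,f$) if $U|s\rangle=|\varphi_s(f)\rangle$ for all $s\in\mathbb Z_2^m$, where $$|\varphi_s(f)\rangle=\frac1{\sqrt{2^{k-m}}}\sum_{x\in C_s(f)}|x\rangle,\qquad C_s(f)=\{Gy:\ f(y)=s\},$$ and if the range of $U$ is the CSS code with stabilizers $Z^h$ ($h$ a row of $H$) and $X^c$ ($c\in C'=\{Gy: Ay=0\}$), i.e. their simultaneous $+1$ eigenspace. Then for each realization of $f$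 there is an $[[n,m]]$ entanglement generation code that is a P-CSS code for $G,H,f$, such that this random code is $\eta$-good on average: the expectation over $f$ of its error on $\mathcal N_n$ is at most $$\eta=2\sqrt{2\epsilon'+4\sqrt{2\epsilon}}+2\sqrt{2\epsilon},\qquad \epsilon'=2^{-\frac12\left(H_2(XE)_\omega-H_0(E)_\omega+k-n-m\right)} .$$ Here $$\omega^{XBE}=\frac1{2^n}\sum_{x\in\mathbb Z_2^n}|x\rangle\langle x|^X\otimes|\phi_x\rangle\langle\phi_x|^{BE},\qquad |\phi_x\rangle^{BE}=\sum_{u,v}\sqrt{p_{u,v}}\,(-1)^{x\cdot v}|x+u\rangle^B|u,v\rangle^E ,$$ $H_2(\rho)=-\log_2\operatorname{tr}(\rho^2)$ and $H_0(\rho)=\log_2\operatorname{rank}(\rho)$, evaluated on the reduced states $\omega^{XE}$ and $\omega^{E}$. -/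

import Mathlib

noncomputable section

namespace PCSS

open scoped Matrix

/-- The set `ℤ₂ⁿ` of bit strings; it also indexes the computational basis of `n` qubits. -/
abbrev Bits (n : ℕ) : Type := Fin n → ZMod 2

/-! ### Operators, partial traces, trace norm, quantum operations -/

/-- The rank one operator `|ψ⟩⟨ψ|`. -/
def ketbra {a : Type*} (ψ : a → ℂ) : Matrix a a ℂ := Matrix.vecMulVec ψ (star ψ)

/-- Partial trace over the first tensor factor. -/
def traceFst {a b : Type*} [Fintype a] (ρ : Matrix (a × b) (a × b) ℂ) : Matrix b b ℂ :=
  Matrix.of fun i j => ∑ x, ρ (x, i) (x, j)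

/-- Partial trace over the middle factor of a tripartite system. -/
def traceMid {a b c : Type*} [Fintype b] (ρ : Matrix (a × b × c) (a × b × c) ℂ) :
    Matrix (a × c) (a × c) ℂ :=
  Matrix.of fun i j => ∑ y, ρ (i.1, y, i.2) (j.1, y, j.2)

section
open scoped MatrixOrder ComplexOrder Matrix.Norms.L2Operator

/-- The trace norm `‖M‖₁ = tr |M|`, where `|M| = √(Mᴴ M)`. -/
def traceNorm {a : Type*} [Fintype a] [DecidableEq a] (M : Matrix a a ℂ) : ℝ :=
  (CFC.abs M).trace.re

end

/-- The linear map `ρ ↦ A ρ B`. -/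
def sandwich {a b : Type*} [Fintype a] (A : Matrix b a ℂ) (B : Matrix a b ℂ) :
    Matrix a a ℂ →ₗ[ℂ] Matrix b b ℂ where
  toFun ρ := A * ρ * B
  map_add' ρ σ := by rw [Matrix.mul_add, Matrix.add_mul]
  map_smul' c ρ := by simp

/-- `id_R ⊗ T`: the map `T` applied to the second factor of a bipartite operator. -/
def idTensor {r a b : Type*} (T : Matrix a a ℂ →ₗ[ℂ] Matrix b b ℂ)
    (ρ : Matrix (r × a) (r × a) ℂ) : Matrix (r × b) (r × b) ℂ :=
  Matrix.of fun i j => T (Matrix.of fun x y => ρ (i.1, x) (j.1, y)) i.2 j.2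

section
open scoped ComplexOrder

/-- A quantum operation: a completely positive, trace preserving linear map. -/
structure IsQuantumOperation {a b : Type*} [Fintype a] [Fintype b]
    (T : Matrix a a ℂ →ₗ[ℂ] Matrix b b ℂ) : Prop where
  completelyPositive : ∀ (d : ℕ) (ρ : Matrix (Fin d × a) (Fin d × a) ℂ),
    ρ.PosSemidef → (idTensor T ρ).PosSemidef
  tracePreserving : ∀ ρ : Matrix a a ℂ, (T ρ).trace = ρ.trace

end

/-- Rényi entropy of order `2`. -/
def renyiTwo {a : Type*} [Fintype a] [DecidableEq a] (ρ : Matrix a a ℂ) : ℝ :=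
  1 / (1 - 2) * Real.logb 2 (ρ ^ 2).trace.re

/-- Rényi entropy of order `0`. -/
def renyiZero {a : Type*} [Fintype a] (ρ : Matrix a a ℂ) : ℝ :=
  Real.logb 2 ρ.rank

/-! ### Pauli channels -/

/-- The sign `(-1) ^ (x · v)`. -/
def sign {n : ℕ} (x v : Bits n) : ℂ := (-1) ^ (x ⬝ᵥ v).val

/-- The operator `X^u = X^{u₁} ⊗ ⋯ ⊗ X^{uₙ}`, i.e. `|x⟩ ↦ |x + u⟩`. -/
def pauliX {n : ℕ} (u : Bits n) : Matrix (Bits n) (Bits n) ℂ :=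
  Matrix.of fun y x => if y = x + u then 1 else 0

/-- The operator `Z^v = Z^{v₁} ⊗ ⋯ ⊗ Z^{vₙ}`, i.e. `|x⟩ ↦ (-1)^{x·v} |x⟩`. -/
def pauliZ {n : ℕ} (v : Bits n) : Matrix (Bits n) (Bits n) ℂ :=
  Matrix.diagonal fun x => sign x v

/-- An `n`-qubit Pauli channel, given by the probabilities of the errors `X^u Z^v`. -/
structure PauliChannel (n : ℕ) where
  p : Bits n → Bits n → ℝ
  nonneg : ∀ u v, 0 ≤ p u v
  sum_eq_one : ∑ u, ∑ v, p u v = 1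

namespace PauliChannel

variable {n : ℕ} (N : PauliChannel n)

/-- The action `ρ ↦ ∑ p_{u,v} X^u Z^v ρ Z^v X^u`. -/
def toLinearMap : Matrix (Bits n) (Bits n) ℂ →ₗ[ℂ] Matrix (Bits n) (Bits n) ℂ :=
  ∑ u, ∑ v, (N.p u v : ℂ) • sandwich (pauliX u * pauliZ v) (pauliZ v * pauliX u)

/-- The state `|φ_x⟩^{BE} = ∑ √p_{u,v} (-1)^{x·v} |x+u⟩^B |u,v⟩^E`, the image of `|x⟩` under the
isometric extension of the channel. -/
def phi (x : Bits n) : Bits n × (Bits n × Bits n) → ℂ :=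
  fun i => if i.1 = x + i.2.1 then (Real.sqrt (N.p i.2.1 i.2.2) : ℂ) * sign x i.2.2 else 0

/-- `ω^{XBE} = 2⁻ⁿ ∑ₓ |x⟩⟨x|^X ⊗ |φ_x⟩⟨φ_x|^{BE}`. -/
def omega : Matrix (Bits n × Bits n × (Bits n × Bits n)) (Bits n × Bits n × (Bits n × Bits n)) ℂ :=
  (1 / 2 ^ n : ℂ) • ∑ x, Matrix.kronecker (Matrix.single x x (1 : ℂ)) (ketbra (N.phi x))

def omegaXE : Matrix (Bits n × (Bits n × Bits n)) (Bits n × (Bits n × Bits n)) ℂ :=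
  traceMid N.omega

def omegaE : Matrix (Bits n × Bits n) (Bits n × Bits n) ℂ :=
  traceFst N.omegaXE

/-- The probability `p_u` of the bit flip error `u`. -/
def bitFlip (u : Bits n) : ℝ := ∑ v, N.p u v

end PauliChannel

/-! ### Classical codes -/

/-- An `[n, k]` linear code with its generator matrix `G`, parity check matrix `H` and the inverse
syndrome function `uHat` by which it is decoded. -/
structure ClassicalCode (n k : ℕ) where
  C : Submodule (ZMod 2) (Bits n)
  finrank_eq : Module.finrank (ZMod 2) C = k
  G : Matrix (Fin n) (Fin k) (ZMod 2)
  range_G : LinearMap.range G.mulVecLin = C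
  H : Matrix (Fin (n - k)) (Fin n) (ZMod 2)
  ker_H : LinearMap.ker H.mulVecLin = C
  uHat : Bits (n - k) → Bits n
  syndrome_uHat : ∀ e, H *ᵥ uHat e = e

namespace ClassicalCode

variable {n k : ℕ} (K : ClassicalCode n k) (N : PauliChannel n)

/-- `p_e`, the probability of the syndrome `e`. -/
def syndromeProb (e : Bits (n - k)) : ℝ := ∑ u with K.H *ᵥ u = e, N.bitFlip u

/-- `p_{u|e}`, the probability of the bit flip error `u` given the syndrome `e`. -/
def condProb (u : Bits n) (e : Bits (n - k)) : ℝ :=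
  (if K.H *ᵥ u = e then 1 else 0) * N.bitFlip u / K.syndromeProb N e

/-- The average error probability `ε = ∑ₑ p_e (1 - p_{û(e)|e})`. (Syndromes of probability zero
contribute nothing.) -/
def avgError : ℝ := ∑ e, K.syndromeProb N e * (1 - K.condProb N (K.uHat e) e)

/-- `C_s(f) = {G y : f(y) = s}`. -/
def cosetSet {m : ℕ} (f : Bits k → Bits m) (s : Bits m) : Set (Bits n) :=
  {x | ∃ y, x = K.G *ᵥ y ∧ f y = s}

open Classical in
/-- The quantum codeword `|φ_s(f)⟩ = 2^{-(k-m)/2} ∑_{x ∈ C_s(f)} |x⟩`. -/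
def codeword {m : ℕ} (f : Bits k → Bits m) (s : Bits m) : Bits n → ℂ :=
  fun x => if x ∈ K.cosetSet f s then ((1 / Real.sqrt (2 ^ ((k : ℤ) - (m : ℤ))) : ℝ) : ℂ) else 0

end ClassicalCode

/-! ### Random affine hash functions -/

/-- `f(y) = A y + s₀` with an `m × k` matrix `A` of full rank `m`. -/
def IsFullRankAffine {k m : ℕ} (f : Bits k → Bits m) : Prop :=
  ∃ (A : Matrix (Fin m) (Fin k) (ZMod 2)) (s₀ : Bits m),
    A.rank = m ∧ ∀ y, f y = A *ᵥ y + s₀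

/-- A random function (given by its law) is two-universal if `Pr[f(y) = f(y')] ≤ 2⁻ᵐ` for all
distinct `y, y'`. -/
def IsTwoUniversal {k m : ℕ} (P : PMF (Bits k → Bits m)) : Prop :=
  ∀ y y' : Bits k, y ≠ y' → ∑ f with f y = f y', (P f).toReal ≤ 1 / (Fintype.card (Bits m) : ℝ)

/-! ### Entanglement generation codes -/

/-- The vector `|Φ⟩^{⊗m} = 2^{-m/2} ∑_s |s⟩|s⟩`. -/
def ebits (m : ℕ) : Bits m × Bits m → ℂ :=
  fun i => if i.1 = i.2 then ((1 / Real.sqrt (2 ^ m) : ℝ) : ℂ) else 0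

/-- An `[[n, m]]` entanglement generation code: an encoding isometry and a decoding operation. -/
structure EntGenCode (n m : ℕ) where
  encoder : Matrix (Bits n) (Bits m) ℂ
  isometry : encoderᴴ * encoder = 1
  decoder : Matrix (Bits n) (Bits n) ℂ →ₗ[ℂ] Matrix (Bits m) (Bits m) ℂ
  isQuantumOperation : IsQuantumOperation decoder

/-- `‖(𝒟 ∘ 𝒩 ∘ U)(Φ^{⊗m}) - Φ^{⊗m}‖₁`, the operations acting on the second half of the ebits.
The code is `η`-good if this is at most `η`. -/
def EntGenCode.error {n m : ℕ} (Q : EntGenCode n m) (N : PauliChannel n) : ℝ :=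
  traceNorm
    (idTensor (Q.decoder ∘ₗ N.toLinearMap ∘ₗ sandwich Q.encoder Q.encoderᴴ) (ketbra (ebits m))
      - ketbra (ebits m))

/-- `Q` is a P-CSS code built from the classical code `K` and the affine function `f`: the encoder
takes the basis vector `|s⟩` to the codeword `|φ_s(f)⟩`, and the code space is the CSS code with
stabilizers `Z^h`, `h` a row of `H`, and `X^c`, `c ∈ C' = {G y : f(y) = f(0)}`. -/
structure EntGenCode.IsPCSS {n k m : ℕ} (Q : EntGenCode n m) (K : ClassicalCode n k)
    (f : Bits k → Bits m) : Prop where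
  encoder_eq : ∀ s x, Q.encoder x s = K.codeword f s x
  stabilized : ∀ ψ : Bits n → ℂ, ψ ∈ LinearMap.range Q.encoder.mulVecLin ↔
    (∀ i, pauliZ (K.H i) *ᵥ ψ = ψ) ∧ ∀ c ∈ K.cosetSet f (f 0), pauliX c *ᵥ ψ = ψ

/-- A random code, one code for each realization of `f`, is `η`-good on average. -/
def IsGoodOnAverage {n k m : ℕ} (P : PMF (Bits k → Bits m))
    (Q : (Bits k → Bits m) → EntGenCode n m) (N : PauliChannel n) (η : ℝ) : Prop :=
  ∑ f, (P f).toReal * (Q f).error N ≤ η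

/-- `ε' = 2^{-(H₂(XE)_ω - H₀(E)_ω + k - n - m)/2}`. -/
def privacyError {n : ℕ} (N : PauliChannel n) (k m : ℕ) : ℝ :=
  (2 : ℝ) ^ (-(1 / 2 : ℝ) *
    (renyiTwo N.omegaXE - renyiZero N.omegaE + (k : ℝ) - (n : ℝ) - (m : ℝ)))

end PCSS

end

/-! The decoder is explicit. From the `Z`-syndrome it estimates the bit flip `u`. From the
`X^c`-syndrome and this `u` it picks a phase error `d u v` that is compatible with the syndrome and,
if possible, has positive probability jointly with `u`. It then undoes both and inverts the
encoding. Whenever the bit flip is right and `Z^{d+v}` is trivial on `C`, the state is restored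
exactly, so the trace-norm error is at most twice the probability of failure (`error_pcssCode_le`).

Bit-flip failures have probability `ε` (`avgError_eq`). A phase failure requires a possible phase
error `v'` that acts differently from `v` on `C` but has the same syndrome, i.e. a nonzero `w =
Gᵀ(v' + v)` orthogonal to `ker A`. By a Fourier argument, two-universality makes this happen with
probability at most `2 · 2^{m-k}` for each `w` (`sum_annihilator_le`). A union bound over the `c_u =
phaseCount u` candidates bounds the conditional failure probability by `2 · 2^{m-k} c_u`, hence also
by the square root of this, since it is at most one.

Averaging over `u` with Cauchy–Schwarz gives `√2 (∑ p_u² · 2^{m-k} ∑ c_u)^{1/2}`. Since `tr ω_XE² =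
2^{-n} ∑ p_u²` and `rank ω_E = ∑ c_u`, this is `√2 ε'` (`privacyError_eq`). The resulting bound `2(ε
+ t)` with `t ≤ min(1, √2 ε')` implies the stated one. -/

noncomputable section

namespace PCSS

open scoped Matrix

/-! ### Trace norm of a difference of positive operators. -/

section TraceNorm
open scoped MatrixOrder ComplexOrder Matrix.Norms.L2Operator

lemma traceNorm_eq_sum_abs_eigenvalues {a : Type*} [Fintype a] [DecidableEq a]
    {M : Matrix a a ℂ} (hM : M.IsHermitian) : traceNorm M = ∑ i, |hM.eigenvalues i| := by
  have h : CFC.abs M = cfc (fun x : ℝ => |x|) M := by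
    rw [CFC.abs_eq_cfc_norm M hM]
    rfl
  rw [traceNorm, h, hM.cfc_eq, Matrix.IsHermitian.cfc, Unitary.conjStarAlgAut_apply,
    Matrix.trace_mul_cycle]
  simp [Matrix.trace_diagonal]

/-- In an eigenbasis of `P - Q`, each eigenvalue is a difference of diagonal entries of `P` and `Q`,
both nonnegative, and `|p - q| ≤ p + q`. -/
lemma traceNorm_sub_le {a : Type*} [Fintype a] [DecidableEq a] {P Q : Matrix a a ℂ}
    (hP : P.PosSemidef) (hQ : Q.PosSemidef) :
    traceNorm (P - Q) ≤ P.trace.re + Q.trace.re := by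
  have hM : (P - Q).IsHermitian := hP.isHermitian.sub hQ.isHermitian
  set V : Matrix a a ℂ := (hM.eigenvectorUnitary : Matrix a a ℂ)
  have hVV : V * Vᴴ = 1 := by
    simpa [Matrix.star_eq_conjTranspose] using Unitary.coe_mul_star_self hM.eigenvectorUnitary
  have htr (R : Matrix a a ℂ) : R.trace = ∑ i, (Vᴴ * R * V) i i := by
    calc R.trace = (V * Vᴴ * R).trace := by rw [hVV, Matrix.one_mul]
      _ = (Vᴴ * R * V).trace := by rw [Matrix.mul_assoc, Matrix.trace_mul_comm]
      _ = _ := rfl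
  have hdiag (i : a) : hM.eigenvalues i = ((Vᴴ * P * V) i i).re - ((Vᴴ * Q * V) i i).re := by
    have h := hM.conjStarAlgAut_star_eigenvectorUnitary
    rw [Unitary.conjStarAlgAut_star_apply] at h
    change Vᴴ * (P - Q) * V = _ at h
    have h' := congrArg Complex.re (congrFun (congrFun h i) i)
    rw [Matrix.mul_sub, Matrix.sub_mul, Matrix.sub_apply, Complex.sub_re] at h'
    rw [h']
    simp
  have hPi (i : a) : 0 ≤ ((Vᴴ * P * V) i i).re :=
    (Complex.le_def.1 ((hP.conjTranspose_mul_mul_same V).diag_nonneg (i := i))).1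
  have hQi (i : a) : 0 ≤ ((Vᴴ * Q * V) i i).re :=
    (Complex.le_def.1 ((hQ.conjTranspose_mul_mul_same V).diag_nonneg (i := i))).1
  rw [traceNorm_eq_sum_abs_eigenvalues hM, htr P, htr Q, Complex.re_sum, Complex.re_sum,
    ← Finset.sum_add_distrib]
  refine Finset.sum_le_sum fun i _ => ?_
  rw [hdiag, abs_le]
  constructor <;> linarith [hPi i, hQi i]

end TraceNorm

/-! ### Weighted Kraus maps and their distance from the identity. -/

section Kraus
open scoped ComplexOrder

variable {a b c ι r : Type*} [Fintype a] [Fintype b] [Fintype c] [Fintype ι] [Fintype r]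

set_option linter.unusedSectionVars false

/-- The map `ρ ↦ ∑ wᵢ Mᵢ ρ Mᵢᴴ`. -/
def krausMap (w : ι → ℝ) (M : ι → Matrix b a ℂ) : Matrix a a ℂ →ₗ[ℂ] Matrix b b ℂ :=
  ∑ i, (w i : ℂ) • sandwich (M i) (M i)ᴴ

lemma krausMap_apply (w : ι → ℝ) (M : ι → Matrix b a ℂ) (ρ : Matrix a a ℂ) :
    krausMap w M ρ = ∑ i, (w i : ℂ) • (M i * ρ * (M i)ᴴ) := by
  simp [krausMap, sandwich, LinearMap.sum_apply]

lemma krausMap_comp {κ : Type*} [Fintype κ] (w : ι → ℝ) (M : ι → Matrix c b ℂ)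
    (w' : κ → ℝ) (M' : κ → Matrix b a ℂ) :
    krausMap w M ∘ₗ krausMap w' M' =
      krausMap (fun i : ι × κ => w i.1 * w' i.2) fun i => M i.1 * M' i.2 := by
  refine LinearMap.ext fun ρ => ?_
  simp only [LinearMap.comp_apply, krausMap_apply, Fintype.sum_prod_type, Matrix.mul_sum,
    Matrix.sum_mul, Finset.smul_sum, Matrix.mul_smul, Matrix.smul_mul, smul_smul,
    Matrix.conjTranspose_mul, Matrix.mul_assoc, Complex.ofReal_mul]

lemma krausMap_comp_sandwich (w : ι → ℝ) (M : ι → Matrix c b ℂ) (A : Matrix b a ℂ) :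
    krausMap w M ∘ₗ sandwich A Aᴴ = krausMap w fun i => M i * A := by
  refine LinearMap.ext fun ρ => ?_
  simp [krausMap_apply, sandwich, Matrix.mul_assoc]

lemma trace_krausMap [DecidableEq a] {w : ι → ℝ} {M : ι → Matrix b a ℂ}
    (h : ∑ i, (w i : ℂ) • ((M i)ᴴ * M i) = 1) (ρ : Matrix a a ℂ) :
    (krausMap w M ρ).trace = ρ.trace := by
  calc (krausMap w M ρ).trace = ((∑ i, (w i : ℂ) • ((M i)ᴴ * M i)) * ρ).trace := by
        simp only [krausMap_apply, Matrix.trace_sum, Matrix.sum_mul, Matrix.trace_smul,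
          Matrix.smul_mul]
        refine Finset.sum_congr rfl fun i _ => ?_
        rw [Matrix.trace_mul_comm, Matrix.mul_assoc]
    _ = ρ.trace := by rw [h, Matrix.one_mul]

lemma idTensor_krausMap [DecidableEq r] (w : ι → ℝ) (M : ι → Matrix b a ℂ)
    (ρ : Matrix (r × a) (r × a) ℂ) :
    idTensor (krausMap w M) ρ = ∑ i, (w i : ℂ) •
      (Matrix.kronecker (1 : Matrix r r ℂ) (M i) * ρ *
        (Matrix.kronecker (1 : Matrix r r ℂ) (M i))ᴴ) := by
  ext i j
  simp only [idTensor, krausMap_apply, Matrix.of_apply, Matrix.sum_apply, Matrix.smul_apply]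
  refine Finset.sum_congr rfl fun l _ => ?_
  congr 1
  simp only [Matrix.mul_apply, Matrix.of_apply, Matrix.conjTranspose_apply, Matrix.kronecker,
    Matrix.kroneckerMap_apply, Fintype.sum_prod_type, Matrix.one_apply]
  simp [Finset.sum_mul, apply_ite (starRingEnd ℂ), Finset.sum_ite_irrel]

lemma idTensor_krausMap_posSemidef {w : ι → ℝ} (hw : ∀ i, 0 ≤ w i) (M : ι → Matrix b a ℂ)
    {ρ : Matrix (r × a) (r × a) ℂ} (hρ : ρ.PosSemidef) :
    (idTensor (krausMap w M) ρ).PosSemidef := by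
  classical
  rw [idTensor_krausMap]
  refine Matrix.posSemidef_sum _ fun i _ => ?_
  exact (hρ.mul_mul_conjTranspose_same _).smul (by exact_mod_cast hw i)

lemma isQuantumOperation_krausMap [DecidableEq a] {w : ι → ℝ} (hw : ∀ i, 0 ≤ w i)
    {M : ι → Matrix b a ℂ} (h : ∑ i, (w i : ℂ) • ((M i)ᴴ * M i) = 1) :
    IsQuantumOperation (krausMap w M) where
  completelyPositive _ _ hρ := idTensor_krausMap_posSemidef hw M hρ
  tracePreserving := trace_krausMap h

lemma trace_idTensor {T : Matrix a a ℂ →ₗ[ℂ] Matrix b b ℂ}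
    (hT : ∀ ρ, (T ρ).trace = ρ.trace) (ρ : Matrix (r × a) (r × a) ℂ) :
    (idTensor T ρ).trace = ρ.trace := by
  have h (i : r) := hT (Matrix.of fun x y => ρ (i, x) (i, y))
  simp only [Matrix.trace, Matrix.diag, Matrix.of_apply] at h
  simp only [Matrix.trace, Matrix.diag, Fintype.sum_prod_type, idTensor, Matrix.of_apply, h]

/-- If a trace preserving map acts as the identity up to weight `δ`, it moves every state by at
most `2 δ` in trace norm. -/
lemma traceNorm_idTensor_krausMap_sub_le [DecidableEq a] [DecidableEq r] {w : ι → ℝ}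
    (hw : ∀ i, 0 ≤ w i) {M : ι → Matrix a a ℂ}
    (htr : ∀ ρ, (krausMap w M ρ).trace = ρ.trace) (good : Finset ι)
    (hgood : ∀ i ∈ good, M i = 1) {δ : ℝ} (hδ : 1 - δ ≤ ∑ i ∈ good, w i)
    {ρ : Matrix (r × a) (r × a) ℂ} (hρ : ρ.PosSemidef) (hρ1 : ρ.trace = 1) :
    traceNorm (idTensor (krausMap w M) ρ - ρ) ≤ 2 * δ := by
  classical
  set g := ∑ i ∈ good, w i with hg
  set R : Matrix (r × a) (r × a) ℂ := ∑ i ∈ goodᶜ, (w i : ℂ) •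
      (Matrix.kronecker (1 : Matrix r r ℂ) (M i) * ρ *
        (Matrix.kronecker (1 : Matrix r r ℂ) (M i))ᴴ) with hR
  have hRpos : R.PosSemidef := Matrix.posSemidef_sum _ fun i _ =>
    (hρ.mul_mul_conjTranspose_same _).smul (by exact_mod_cast hw i)
  have hsplit : idTensor (krausMap w M) ρ = (g : ℂ) • ρ + R := by
    rw [idTensor_krausMap, ← Finset.sum_add_sum_compl good, hR, hg]
    congr 1
    rw [Complex.ofReal_sum, Finset.sum_smul]
    refine Finset.sum_congr rfl fun i hi => ?_
    rw [hgood i hi]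
    simp [Matrix.kronecker]
  have hRtr : R.trace = ((1 - g : ℝ) : ℂ) := by
    have h := trace_idTensor htr ρ
    rw [hsplit, Matrix.trace_add, Matrix.trace_smul, hρ1] at h
    push_cast
    rw [← h]
    simp
  have hg1 : 0 ≤ 1 - g := by
    have := hRpos.trace_nonneg
    rw [hRtr] at this
    exact_mod_cast this
  have hQ : (((1 - g : ℝ) : ℂ) • ρ).PosSemidef := hρ.smul (by exact_mod_cast hg1)
  -- Both terms on the right are positive of trace `1 - g ≤ δ`, which gives the factor 2.
  have heq : idTensor (krausMap w M) ρ - ρ = R - ((1 - g : ℝ) : ℂ) • ρ := by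
    rw [hsplit]
    push_cast
    rw [sub_smul, one_smul]
    abel
  rw [heq]
  refine (traceNorm_sub_le hRpos hQ).trans ?_
  rw [Matrix.trace_smul, hρ1, hRtr, smul_eq_mul, mul_one, Complex.ofReal_re]
  linarith

end Kraus

/-! ### Characters of `ℤ₂ⁿ` and their orthogonality. -/

section Sign

variable {n k m : ℕ}

lemma bits_add_self (x : Bits n) : x + x = 0 := by
  ext i
  exact CharTwo.add_self_eq_zero _

lemma bits_add_add_cancel (x y : Bits n) : x + y + y = x := by
  rw [add_assoc, bits_add_self, add_zero]

lemma bits_add_eq_zero {x y : Bits n} : x + y = 0 ↔ x = y :=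
  ⟨fun h => by rw [← bits_add_add_cancel x y, h, zero_add], fun h => by rw [h, bits_add_self]⟩

lemma bits_eq_add_iff {x y z : Bits n} : x = y + z ↔ x + z = y :=
  ⟨fun h => by rw [h, bits_add_add_cancel], fun h => by rw [← h, bits_add_add_cancel]⟩

lemma neg_one_pow_val_add (a b : ZMod 2) :
    (-1 : ℂ) ^ (a + b).val = (-1) ^ a.val * (-1) ^ b.val := by
  rw [← pow_add, ZMod.val_add, neg_one_pow_eq_pow_mod_two (n := a.val + b.val)]

lemma sign_add_left (x y v : Bits n) : sign (x + y) v = sign x v * sign y v := by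
  rw [sign, add_dotProduct, neg_one_pow_val_add]
  rfl

lemma sign_add_right (x v w : Bits n) : sign x (v + w) = sign x v * sign x w := by
  rw [sign, dotProduct_add, neg_one_pow_val_add]
  rfl

lemma sign_comm (x v : Bits n) : sign x v = sign v x := by
  rw [sign, dotProduct_comm, sign]

@[simp] lemma sign_zero_left (v : Bits n) : sign 0 v = 1 := by simp [sign]

@[simp] lemma sign_zero_right (v : Bits n) : sign v 0 = 1 := by simp [sign]

lemma sign_eq_one_or (x v : Bits n) : sign x v = 1 ∨ sign x v = -1 :=
  neg_one_pow_eq_or ℂ _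

@[simp] lemma sign_mul_self (x v : Bits n) : sign x v * sign x v = 1 := by
  rcases sign_eq_one_or x v with h | h <;> simp [h]

@[simp] lemma conj_sign (x v : Bits n) : (starRingEnd ℂ) (sign x v) = sign x v := by
  rcases sign_eq_one_or x v with h | h <;> simp [h]

lemma sign_re_le_one (x v : Bits n) : |(sign x v).re| ≤ 1 := by
  rcases sign_eq_one_or x v with h | h <;> simp [h]

lemma sign_eq_one_iff (x v : Bits n) : sign x v = 1 ↔ x ⬝ᵥ v = 0 := by
  rw [sign, neg_one_pow_eq_one_iff_even (by norm_num)]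
  generalize x ⬝ᵥ v = a
  revert a
  decide

lemma sign_mulVec (M : Matrix (Fin n) (Fin k) (ZMod 2)) (y : Bits k) (v : Bits n) :
    sign (M *ᵥ y) v = sign y (Mᵀ *ᵥ v) := by
  rw [sign, sign, Matrix.dotProduct_mulVec, Matrix.vecMul_transpose]

lemma eq_zero_of_forall_sign_eq_one {w : Bits n} (h : ∀ x, sign x w = 1) : w = 0 := by
  ext i
  simpa using (sign_eq_one_iff _ _).1 (h (Pi.single i 1))

open Classical in
/-- Orthogonality of characters on a set of bit strings that is closed under addition. -/
lemma sum_sign_eq {s : Finset (Bits n)} (hs : ∀ x ∈ s, ∀ y ∈ s, x + y ∈ s) (w : Bits n) :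
    ∑ x ∈ s, sign x w = if ∀ x ∈ s, sign x w = 1 then (s.card : ℂ) else 0 := by
  split_ifs with h
  · rw [Finset.sum_congr rfl h]
    simp
  · push Not at h
    obtain ⟨a, ha, haw⟩ := h
    have haw' : sign a w = -1 := (sign_eq_one_or a w).resolve_left haw
    -- Translation by `a`, a point of sign `-1`, pairs off terms of opposite sign.
    refine Finset.sum_involution (fun x _ => x + a) (fun x _ => ?_) (fun x _ hx hxa => ?_)
      (fun x hx => hs x hx a ha) fun x _ => bits_add_add_cancel x a
    · simp [sign_add_left, haw']
    · exact haw (by rw [add_eq_left.1 hxa, sign_zero_left])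

lemma sum_univ_sign (w : Bits n) : ∑ x, sign x w = if w = 0 then (2 : ℂ) ^ n else 0 := by
  classical
  rw [sum_sign_eq (fun _ _ _ _ => Finset.mem_univ _)]
  by_cases h : w = 0
  · simp [h]
  · rw [if_neg h, if_neg]
    exact fun h' => h (eq_zero_of_forall_sign_eq_one fun x => h' x (Finset.mem_univ x))

end Sign

/-! ### Full rank affine functions and two-universality. -/

section Hash

lemma sum_pmf_toReal {α : Type*} [Fintype α] (P : PMF α) : ∑ a, (P a).toReal = 1 := by
  have := P.tsum_coe
  rw [tsum_fintype] at this
  rw [← ENNReal.toReal_sum fun a _ => P.apply_ne_top a, this, ENNReal.toReal_one]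

variable {k m : ℕ} {f : Bits k → Bits m}

lemma IsFullRankAffine.eq_iff (hf : IsFullRankAffine f) (y y' : Bits k) :
    f y = f y' ↔ f (y + y') = f 0 := by
  obtain ⟨A, s₀, -, h⟩ := hf
  rw [h, h, h, h, Matrix.mulVec_zero, Matrix.mulVec_add, add_left_inj, add_left_inj,
    bits_add_eq_zero]

lemma IsFullRankAffine.surjective (hf : IsFullRankAffine f) : Function.Surjective f := by
  obtain ⟨A, s₀, hA, h⟩ := hf
  have htop : LinearMap.range A.mulVecLin = ⊤ := by
    apply Submodule.eq_top_of_finrank_eq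
    rw [← Matrix.rank, hA]
    simp
  intro s
  obtain ⟨y, hy⟩ := LinearMap.range_eq_top.1 htop (s + s₀)
  exact ⟨y, by rw [h, ← Matrix.mulVecLin_apply, hy, bits_add_add_cancel]⟩

lemma IsFullRankAffine.le (hf : IsFullRankAffine f) : m ≤ k := by
  have h := Fintype.card_le_of_surjective f hf.surjective
  simp only [Fintype.card_pi, ZMod.card, Finset.prod_const, Finset.card_univ,
    Fintype.card_fin] at h
  exact (Nat.pow_le_pow_iff_right (by norm_num)).1 h

lemma IsFullRankAffine.card_fiber (hf : IsFullRankAffine f) (s : Bits m) :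
    (Finset.univ.filter fun y => f y = s).card = 2 ^ (k - m) := by
  -- All fibres are translates of the fibre of `f 0`, the kernel of the linear part.
  have hfib (s : Bits m) : (Finset.univ.filter fun y => f y = s).card =
      (Finset.univ.filter fun y => f y = f 0).card := by
    obtain ⟨y₀, rfl⟩ := hf.surjective s
    refine Finset.card_bij' (fun y _ => y + y₀) (fun y _ => y + y₀) ?_ ?_ ?_ ?_
    · intro y hy
      simpa [← hf.eq_iff] using hy
    · intro y hy
      simp only [Finset.mem_filter, Finset.mem_univ, true_and] at hy ⊢
      rwa [hf.eq_iff, bits_add_add_cancel]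
    · exact fun y _ => bits_add_add_cancel y y₀
    · exact fun y _ => bits_add_add_cancel y y₀
  have htot : (Finset.univ : Finset (Bits k)).card =
      ∑ s, (Finset.univ.filter fun y => f y = s).card :=
    Finset.card_eq_sum_card_fiberwise fun _ _ => Finset.mem_coe.2 (Finset.mem_univ _)
  simp only [hfib, Finset.sum_const, Finset.card_univ, Fintype.card_pi, ZMod.card,
    Finset.prod_const, Fintype.card_fin, smul_eq_mul] at htot
  rw [hfib]
  have h2 : 2 ^ m * (Finset.univ.filter fun y => f y = f 0).card = 2 ^ m * 2 ^ (k - m) := by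
    rw [← htot, ← pow_add, Nat.add_sub_cancel' hf.le]
  exact Nat.eq_of_mul_eq_mul_left (by positivity) h2

open Classical in
/-- The annihilator of the kernel of a two-universal random full rank affine function contains a
given nonzero bit string with probability at most `2 · 2^{m-k}`. -/
lemma IsTwoUniversal.sum_annihilator_le {P : PMF (Bits k → Bits m)}
    (hP : IsTwoUniversal P) (hA : ∀ f ∈ P.support, IsFullRankAffine f) {w : Bits k}
    (hw : w ≠ 0) :
    ∑ f with ∀ y, f y = f 0 → sign y w = 1, (P f).toReal ≤ 2 * (2 ^ m / 2 ^ k) := by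
  have hsum := sum_pmf_toReal P
  obtain ⟨f₀, hf₀⟩ := P.support_nonempty
  have hmk := (hA f₀ hf₀).le
  have hpow : (2 : ℝ) ^ (k - m) = 2 ^ k / 2 ^ m := by
    rw [eq_div_iff (by positivity), ← pow_add, Nat.sub_add_cancel hmk]
  set q : Bits k → ℝ := fun y => ∑ f with f y = f 0, (P f).toReal with hq
  have hq0 : q 0 = 1 := by simp [hq, hsum]
  have hqle (y : Bits k) (hy : y ≠ 0) : q y ≤ 1 / 2 ^ m := by
    simpa using hP y 0 hy
  -- The mean of `q` is exactly `2^{-m}`, because every realization in the support has a kernel of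
  -- size `2^{k-m}`.
  have hqsum : ∑ y, q y = 2 ^ k / 2 ^ m := by
    simp only [hq, Finset.sum_filter]
    rw [Finset.sum_comm, ← mul_one (2 ^ k / 2 ^ m : ℝ), ← hsum, Finset.mul_sum]
    refine Finset.sum_congr rfl fun f _ => ?_
    by_cases hf : f ∈ P.support
    · rw [← Finset.sum_filter, Finset.sum_const, (hA f hf).card_fiber, nsmul_eq_mul]
      push_cast
      rw [hpow]
    · simp [(PMF.apply_eq_zero_iff P f).2 hf]
  -- The indicator that `w` annihilates the kernel, times the kernel's size, is the character sum of
  -- `w` over the kernel.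
  have hind (f : Bits k → Bits m) : (2 ^ k / 2 ^ m) *
      (if ∀ y, f y = f 0 → sign y w = 1 then (P f).toReal else 0) =
      ∑ y, (sign y w).re * if f y = f 0 then (P f).toReal else 0 := by
    by_cases hf : f ∈ P.support
    · have hs := sum_sign_eq (s := Finset.univ.filter fun y => f y = f 0)
        (fun x hx y hy => by
          simp only [Finset.mem_filter, Finset.mem_univ, true_and] at hx hy ⊢
          rw [← (hA f hf).eq_iff, hx, hy]) w
      have hs' := congrArg Complex.re hs
      simp only [Finset.mem_filter, Finset.mem_univ, true_and, (hA f hf).card_fiber,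
        Complex.re_sum] at hs'
      have : ∑ y, (sign y w).re * (if f y = f 0 then (P f).toReal else 0) =
          (∑ y with f y = f 0, (sign y w).re) * (P f).toReal := by
        rw [Finset.sum_filter, Finset.sum_mul]
        exact Finset.sum_congr rfl fun y _ => by split_ifs <;> simp
      rw [this, hs', ← hpow]
      split_ifs
      · rw [Nat.cast_pow, ← Complex.ofReal_natCast, ← Complex.ofReal_pow, Complex.ofReal_re]
        simp
      · simp
    · simp [(PMF.apply_eq_zero_iff P f).2 hf]
  have hfourier : (2 ^ k / 2 ^ m) * ∑ f with ∀ y, f y = f 0 → sign y w = 1, (P f).toReal =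
      ∑ y, (sign y w).re * q y := by
    simp only [hq, Finset.sum_filter, Finset.mul_sum, hind]
    rw [Finset.sum_comm]
  have hzero : ∑ y : Bits k, (sign y w).re = 0 := by
    rw [← Complex.re_sum, sum_univ_sign, if_neg hw, Complex.zero_re]
  -- As `w ≠ 0`, the constant `2^{-m}` can be subtracted from `q`. The excess at `y = 0` is `1 -
  -- 2^{-m}`; since `q` has mean `2^{-m}` and lies below it elsewhere, the total deficit at `y ≠ 0`
  -- is the same number. Hence the 2.
  have hbound : ∑ y, (sign y w).re * q y ≤ 2 := by
    calc ∑ y, (sign y w).re * q y = ∑ y, (sign y w).re * (q y - 1 / 2 ^ m) := by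
          simp only [mul_sub, Finset.sum_sub_distrib, ← Finset.sum_mul, hzero]
          simp
      _ ≤ ∑ y, ((1 / 2 ^ m - q y) + if y = 0 then 2 * (1 - 1 / 2 ^ m) else 0) := by
          refine Finset.sum_le_sum fun y _ => ?_
          by_cases hy : y = 0
          · rw [if_pos hy, hy, hq0, sign_zero_left, Complex.one_re]
            linarith
          · rw [if_neg hy]
            have := (abs_le.1 (sign_re_le_one y w)).1
            nlinarith [hqle y hy]
      _ = 2 * (1 - 1 / 2 ^ m) := by
          rw [Finset.sum_add_distrib, Finset.sum_sub_distrib, hqsum]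
          simp
          ring
      _ ≤ 2 := by
          have : (0 : ℝ) ≤ 1 / 2 ^ m := by positivity
          linarith
  rw [← hfourier] at hbound
  rw [← mul_div_assoc, le_div_iff₀ (by positivity)]
  rw [div_mul_eq_mul_div, div_le_iff₀ (by positivity)] at hbound
  linarith

end Hash

/-! ### Pauli operators and the Pauli channel in Kraus form. -/

section Pauli

variable {n : ℕ}

lemma pauliX_mulVec (u : Bits n) (ψ : Bits n → ℂ) (x : Bits n) :
    (pauliX u *ᵥ ψ) x = ψ (x + u) := by
  simp only [pauliX, Matrix.mulVec, dotProduct, Matrix.of_apply, bits_eq_add_iff]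
  simp

lemma pauliX_mul_self (u : Bits n) : pauliX u * pauliX u = 1 := by
  ext x y
  simp only [pauliX, Matrix.mul_apply, Matrix.of_apply, Matrix.one_apply]
  have h (z : Bits n) : x = z + u ↔ z = x + u := by
    rw [bits_eq_add_iff, eq_comm]
  simp only [h, ite_mul, zero_mul, one_mul, Finset.sum_ite_eq', Finset.mem_univ, if_true,
    add_left_inj]

lemma pauliZ_mul (v w : Bits n) : pauliZ v * pauliZ w = pauliZ (v + w) := by
  simp [pauliZ, Matrix.diagonal_mul_diagonal, sign_add_right]

lemma conjTranspose_pauli (u v : Bits n) : (pauliX u * pauliZ v)ᴴ = pauliZ v * pauliX u := by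
  rw [Matrix.conjTranspose_mul]
  congr 1
  · rw [pauliZ, Matrix.diagonal_conjTranspose]
    congr 1
    ext x
    simp
  · ext x y
    have h : y = x + u ↔ x = y + u := by rw [bits_eq_add_iff, eq_comm]
    simp only [pauliX, Matrix.conjTranspose_apply, Matrix.of_apply, h]
    simp

lemma conjTranspose_pauli_mul_pauli (u v w : Bits n) :
    (pauliX u * pauliZ v)ᴴ * (pauliX u * pauliZ w) = pauliZ (v + w) := by
  rw [conjTranspose_pauli, Matrix.mul_assoc, ← Matrix.mul_assoc (pauliX u), pauliX_mul_self,
    Matrix.one_mul, pauliZ_mul]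

lemma pauli_mul_mul_conjTranspose_apply (u v : Bits n) (M : Matrix (Bits n) (Bits n) ℂ)
    (x y : Bits n) : ((pauliX u * pauliZ v) * M * (pauliX u * pauliZ v)ᴴ) x y =
      sign (x + y) v * M (x + u) (y + u) := by
  have h (x y : Bits n) : (pauliX u * pauliZ v) x y = if x + u = y then sign y v else 0 := by
    simp only [pauliZ, Matrix.mul_diagonal, pauliX, Matrix.of_apply, bits_eq_add_iff]
    simp
  simp only [Matrix.mul_apply (M := _ * M), Matrix.mul_apply (N := M), h,
    Matrix.conjTranspose_apply]
  simp only [ite_mul, zero_mul, Finset.sum_ite_eq, Finset.mem_univ, if_true,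
    apply_ite (star : ℂ → ℂ), star_zero, mul_ite, mul_zero]
  have hs := sign_mul_self u v
  simp only [sign_add_left, RCLike.star_def, map_mul, conj_sign]
  linear_combination (sign x v * sign y v * M (x + u) (y + u)) * hs

lemma PauliChannel.toLinearMap_eq_krausMap (N : PauliChannel n) :
    N.toLinearMap = krausMap (fun i : Bits n × Bits n => N.p i.1 i.2)
      fun i => pauliX i.1 * pauliZ i.2 := by
  simp only [PauliChannel.toLinearMap, krausMap, Fintype.sum_prod_type, conjTranspose_pauli]

lemma PauliChannel.trace_toLinearMap (N : PauliChannel n) (ρ : Matrix (Bits n) (Bits n) ℂ) :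
    (N.toLinearMap ρ).trace = ρ.trace := by
  rw [N.toLinearMap_eq_krausMap]
  refine trace_krausMap ?_ ρ
  have h1 (i : Bits n × Bits n) :
      (pauliX i.1 * pauliZ i.2)ᴴ * (pauliX i.1 * pauliZ i.2) = 1 := by
    rw [conjTranspose_pauli_mul_pauli, bits_add_self]
    simp [pauliZ]
  simp only [h1, ← Finset.sum_smul, ← Complex.ofReal_sum, Fintype.sum_prod_type, N.sum_eq_one]
  simp

end Pauli

open scoped ComplexOrder in
lemma ketbra_posSemidef {a : Type*} [Finite a] (ψ : a → ℂ) : (ketbra ψ).PosSemidef :=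
  Matrix.posSemidef_vecMulVec_self_star ψ

lemma trace_ketbra_ebits (m : ℕ) : (ketbra (ebits m)).trace = 1 := by
  have h : ((1 / Real.sqrt (2 ^ m) : ℝ) : ℂ) * ((1 / Real.sqrt (2 ^ m) : ℝ) : ℂ) =
      1 / 2 ^ m := by
    rw [← Complex.ofReal_mul, div_mul_div_comm, Real.mul_self_sqrt (by positivity)]
    simp
  simp only [Matrix.trace, Matrix.diag, ketbra, Matrix.vecMulVec_apply, Pi.star_apply, ebits,
    Fintype.sum_prod_type, apply_ite (star : ℂ → ℂ), star_zero, mul_ite, ite_mul, zero_mul,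
    mul_zero, Finset.sum_ite_eq, Finset.mem_univ, if_true, RCLike.star_def, Complex.conj_ofReal, h]
  simp

/-! ### The encoder and its stabilizers. -/

namespace ClassicalCode

variable {n k m : ℕ} (K : ClassicalCode n k) {f : Bits k → Bits m}

lemma mulVec_injective : Function.Injective fun y => K.G *ᵥ y := by
  have h := LinearMap.finrank_range_add_finrank_ker K.G.mulVecLin
  rw [K.range_G, K.finrank_eq] at h
  have h0 : Module.finrank (ZMod 2) (LinearMap.ker K.G.mulVecLin) = 0 := by
    simpa using h
  exact LinearMap.ker_eq_bot.1 (Submodule.finrank_eq_zero.1 h0)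

lemma parity_eq_zero_iff {x : Bits n} : K.H *ᵥ x = 0 ↔ ∃ y, x = K.G *ᵥ y := by
  have h : x ∈ LinearMap.ker K.H.mulVecLin ↔ x ∈ LinearMap.range K.G.mulVecLin := by
    rw [K.ker_H, K.range_G]
  simpa [eq_comm] using h

lemma parity_mulVec (y : Bits k) : K.H *ᵥ (K.G *ᵥ y) = 0 :=
  K.parity_eq_zero_iff.2 ⟨y, rfl⟩

lemma mulVec_mem_cosetSet {y : Bits k} {s : Bits m} :
    K.G *ᵥ y ∈ K.cosetSet f s ↔ f y = s :=
  ⟨fun ⟨_, h, hs⟩ => K.mulVec_injective h ▸ hs, fun h => ⟨y, rfl, h⟩⟩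

lemma parity_of_mem_cosetSet {x : Bits n} {s : Bits m} (h : x ∈ K.cosetSet f s) :
    K.H *ᵥ x = 0 := by
  obtain ⟨y, rfl, -⟩ := h
  exact K.parity_mulVec y

variable (k m) in
/-- The amplitude `2^{-(k-m)/2}` of a codeword. -/
def amplitude : ℂ := ((1 / Real.sqrt (2 ^ ((k : ℤ) - (m : ℤ))) : ℝ) : ℂ)

lemma amplitude_ne_zero : amplitude k m ≠ 0 := by
  have : (0 : ℝ) < 1 / Real.sqrt (2 ^ ((k : ℤ) - (m : ℤ))) := by positivity
  exact Complex.ofReal_ne_zero.2 this.ne'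

lemma conj_amplitude : (starRingEnd ℂ) (amplitude k m) = amplitude k m :=
  Complex.conj_ofReal _

lemma amplitude_mul_self : amplitude k m * amplitude k m = 2 ^ m / 2 ^ k := by
  rw [amplitude, ← Complex.ofReal_mul, div_mul_div_comm, Real.mul_self_sqrt (by positivity),
    zpow_sub₀ (by norm_num)]
  simp

open Classical in
lemma codeword_mulVec (y : Bits k) (s : Bits m) :
    K.codeword f s (K.G *ᵥ y) = if f y = s then amplitude k m else 0 := by
  simp only [codeword, K.mulVec_mem_cosetSet, amplitude]

lemma codeword_eq_zero {x : Bits n} (hx : K.H *ᵥ x ≠ 0) (s : Bits m) :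
    K.codeword f s x = 0 :=
  if_neg fun h => hx (K.parity_of_mem_cosetSet h)

lemma sum_eq_sum_mulVec {g : Bits n → ℂ} (hg : ∀ x, K.H *ᵥ x ≠ 0 → g x = 0) :
    ∑ x, g x = ∑ y, g (K.G *ᵥ y) := by
  refine (Fintype.sum_of_injective _ K.mulVec_injective _ _ (fun x hx => ?_) fun _ => rfl).symm
  exact hg x fun h => hx (by obtain ⟨y, rfl⟩ := K.parity_eq_zero_iff.1 h; exact ⟨y, rfl⟩)

/-- The matrix whose columns are the codewords. -/
def encoder (f : Bits k → Bits m) : Matrix (Bits n) (Bits m) ℂ :=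
  Matrix.of fun x s => K.codeword f s x

lemma encoder_isometry (hf : IsFullRankAffine f) : (K.encoder f)ᴴ * K.encoder f = 1 := by
  ext s s'
  simp only [Matrix.mul_apply, Matrix.conjTranspose_apply, encoder, Matrix.of_apply]
  rw [K.sum_eq_sum_mulVec fun x hx => by
    rw [K.codeword_eq_zero hx s', mul_zero]]
  simp only [codeword_mulVec, apply_ite (star : ℂ → ℂ), RCLike.star_def, conj_amplitude, map_zero,
    mul_ite, ite_mul, zero_mul, mul_zero, amplitude_mul_self, Matrix.one_apply]
  by_cases h : s = s'
  · subst h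
    simp only [if_true]
    have hc : ∀ y, (if f y = s then (if f y = s then (2 ^ m / 2 ^ k : ℂ) else 0) else 0) =
        if f y = s then (2 ^ m / 2 ^ k : ℂ) else 0 := fun y => by split_ifs <;> rfl
    simp only [hc]
    rw [← Finset.sum_filter, Finset.sum_const, hf.card_fiber, nsmul_eq_mul]
    push_cast
    rw [← mul_div_assoc, ← pow_add, Nat.sub_add_cancel hf.le, div_self (pow_ne_zero _ two_ne_zero)]
  · rw [if_neg h]
    refine Finset.sum_eq_zero fun y _ => ?_
    split_ifs with h1 h2
    · exact absurd (h2.symm.trans h1) h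
    · rfl
    · rfl

open Classical in
/-- The projector onto the code space. -/
lemma encoder_mul_conjTranspose_apply (hf : IsFullRankAffine f) (x x' : Bits n) :
    (K.encoder f * (K.encoder f)ᴴ) x x' =
      if K.H *ᵥ x = 0 ∧ x + x' ∈ K.cosetSet f (f 0) then 2 ^ m / 2 ^ k else 0 := by
  simp only [Matrix.mul_apply, Matrix.conjTranspose_apply, encoder, Matrix.of_apply]
  by_cases hx : K.H *ᵥ x = 0
  · obtain ⟨y, rfl⟩ := K.parity_eq_zero_iff.1 hx
    by_cases hx' : K.H *ᵥ x' = 0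
    · obtain ⟨y', rfl⟩ := K.parity_eq_zero_iff.1 hx'
      rw [← Matrix.mulVec_add, K.mulVec_mem_cosetSet, ← hf.eq_iff]
      simp only [codeword_mulVec, ite_mul, zero_mul, Finset.sum_ite_eq, Finset.mem_univ, if_true,
        apply_ite (star : ℂ → ℂ), RCLike.star_def, conj_amplitude, map_zero, mul_ite, mul_zero,
        amplitude_mul_self, K.parity_mulVec, true_and]
    · rw [if_neg]
      · exact Finset.sum_eq_zero fun s _ => by rw [K.codeword_eq_zero hx', star_zero, mul_zero]
      · rintro ⟨-, h⟩
        have := K.parity_of_mem_cosetSet h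
        rw [Matrix.mulVec_add, hx, zero_add] at this
        exact hx' this
  · rw [if_neg fun h => hx h.1]
    exact Finset.sum_eq_zero fun s _ => by rw [K.codeword_eq_zero hx, zero_mul]

/-- Codewords are supported on `C`. This serves both the stabilizers `Z^h` and the residual phase
error left after correction. -/
lemma pauliZ_mul_encoder {v : Bits n} (hv : ∀ y, sign (K.G *ᵥ y) v = 1) :
    pauliZ v * K.encoder f = K.encoder f := by
  ext x s
  rw [pauliZ, Matrix.diagonal_mul, encoder, Matrix.of_apply]
  by_cases hx : K.H *ᵥ x = 0
  · obtain ⟨y, rfl⟩ := K.parity_eq_zero_iff.1 hx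
    rw [hv, one_mul]
  · rw [K.codeword_eq_zero hx, mul_zero]

lemma sign_mulVec_row (y : Bits k) (i : Fin (n - k)) : sign (K.G *ᵥ y) (K.H i) = 1 := by
  rw [sign_eq_one_iff, dotProduct_comm]
  exact congrFun (K.parity_mulVec y) i

lemma pauliX_mul_encoder (hf : IsFullRankAffine f) {c : Bits n} (hc : c ∈ K.cosetSet f (f 0)) :
    pauliX c * K.encoder f = K.encoder f := by
  obtain ⟨y, rfl, hy⟩ := hc
  ext x s
  have h := pauliX_mulVec (K.G *ᵥ y) (fun x => K.encoder f x s) x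
  refine Eq.trans (by rfl) (h.trans ?_)
  simp only [encoder, Matrix.of_apply]
  by_cases hx : K.H *ᵥ x = 0
  · obtain ⟨z, rfl⟩ := K.parity_eq_zero_iff.1 hx
    have hz : f (z + y) = f z := by
      rw [hf.eq_iff, add_comm, ← add_assoc, bits_add_self, zero_add, hy]
    rw [← Matrix.mulVec_add, codeword_mulVec, codeword_mulVec, hz]
  · rw [K.codeword_eq_zero hx, K.codeword_eq_zero]
    rwa [Matrix.mulVec_add, K.parity_mulVec, add_zero]

/-- The code space is the CSS code of the parity checks and the kernel of `f`. -/
lemma mem_range_encoder_iff (hf : IsFullRankAffine f) (ψ : Bits n → ℂ) :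
    ψ ∈ LinearMap.range (K.encoder f).mulVecLin ↔
      (∀ i, pauliZ (K.H i) *ᵥ ψ = ψ) ∧ ∀ c ∈ K.cosetSet f (f 0), pauliX c *ᵥ ψ = ψ := by
  constructor
  · rintro ⟨φ, rfl⟩
    simp only [Matrix.mulVecLin_apply, Matrix.mulVec_mulVec]
    exact ⟨fun i => by rw [K.pauliZ_mul_encoder fun y => K.sign_mulVec_row y i],
      fun c hc => by rw [K.pauliX_mul_encoder hf hc]⟩
  · rintro ⟨hZ, hX⟩
    choose g hg using hf.surjective
    -- The `X^c` make `ψ` constant on each coset `C_s(f)`, so its value at one representative gives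
    -- the coefficient of `|s⟩`.
    refine ⟨fun s => (amplitude k m)⁻¹ * ψ (K.G *ᵥ g s), funext fun x => ?_⟩
    simp only [Matrix.mulVecLin_apply, Matrix.mulVec, dotProduct, encoder, Matrix.of_apply]
    by_cases hx : K.H *ᵥ x = 0
    · obtain ⟨y, rfl⟩ := K.parity_eq_zero_iff.1 hx
      simp only [codeword_mulVec, ite_mul, zero_mul, Finset.sum_ite_eq, Finset.mem_univ, if_true]
      rw [mul_inv_cancel_left₀ amplitude_ne_zero]
      have hmem : K.G *ᵥ (y + g (f y)) ∈ K.cosetSet f (f 0) := by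
        rw [K.mulVec_mem_cosetSet, ← hf.eq_iff, hg]
      have h := congrFun (hX _ hmem) (K.G *ᵥ y)
      rw [pauliX_mulVec, ← Matrix.mulVec_add, ← add_assoc, bits_add_self, zero_add] at h
      exact h
    · rw [Finset.sum_eq_zero fun s _ => by rw [K.codeword_eq_zero hx, zero_mul]]
      obtain ⟨i, hi⟩ := Function.ne_iff.1 hx
      -- Off `C` a violated check gives `ψ x = -ψ x`.
      have hs : sign x (K.H i) = -1 := by
        refine (sign_eq_one_or _ _).resolve_left fun h => hi ?_
        rw [sign_eq_one_iff, dotProduct_comm] at h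
        exact h
      have h := congrFun (hZ i) x
      rw [pauliZ, Matrix.mulVec_diagonal, hs] at h
      linear_combination h / 2

/-! ### The decoder -/

/-- Two phase errors have the same syndrome if the stabilizers `X^c` do not tell them apart. -/
def SamePhaseSyndrome (f : Bits k → Bits m) (v v' : Bits n) : Prop :=
  ∀ y, f y = f 0 → sign (K.G *ᵥ y) v = sign (K.G *ᵥ y) v'

open Classical in
-- Each class has `2^n / 2^{k-m}` elements, by counting with characters: only `y = 0` survives the
-- sum over `v'`. The weight `2^k / 2^m / 2^n` thus averages over a class, which lets the decoder be
-- indexed by strings instead of phase syndromes.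
lemma sum_samePhaseSyndrome (hf : IsFullRankAffine f) (v : Bits n) :
    ((Finset.univ.filter fun v' => K.SamePhaseSyndrome f v v').card : ℝ) *
      (2 ^ k / 2 ^ m / 2 ^ n) = 1 := by
  set s := Finset.univ.filter fun y => f y = f 0 with hs
  have hclosed : ∀ x ∈ s, ∀ y ∈ s, x + y ∈ s := fun x hx y hy => by
    simp only [hs, Finset.mem_filter, Finset.mem_univ, true_and] at hx hy ⊢
    rw [← hf.eq_iff, hx, hy]
  have hiff (v' : Bits n) : (∀ y ∈ s, sign y (K.Gᵀ *ᵥ (v + v')) = 1) ↔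
      K.SamePhaseSyndrome f v v' := by
    simp only [hs, Finset.mem_filter, Finset.mem_univ, true_and, SamePhaseSyndrome]
    refine forall₂_congr fun y _ => ?_
    rw [← sign_mulVec, sign_add_right]
    constructor
    · intro h
      linear_combination sign (K.G *ᵥ y) v' * h - sign (K.G *ᵥ y) v * sign_mul_self (K.G *ᵥ y) v'
    · intro h
      rw [h, sign_mul_self]
  have hcount : ((Finset.univ.filter fun v' => K.SamePhaseSyndrome f v v').card : ℂ) *
      2 ^ (k - m) = 2 ^ n := by
    calc _ = ∑ v', ∑ y ∈ s, sign y (K.Gᵀ *ᵥ (v + v')) := by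
          simp only [sum_sign_eq hclosed, hiff]
          rw [← Finset.sum_filter, Finset.sum_const, hs, hf.card_fiber, nsmul_eq_mul]
          push_cast
          rfl
      _ = ∑ y ∈ s, sign (K.G *ᵥ y) v * ∑ v', sign v' (K.G *ᵥ y) := by
          rw [Finset.sum_comm]
          refine Finset.sum_congr rfl fun y _ => ?_
          rw [Finset.mul_sum]
          refine Finset.sum_congr rfl fun v' _ => ?_
          rw [← sign_mulVec, sign_add_right, sign_comm v']
      _ = ∑ y ∈ s, if y = 0 then 2 ^ n else 0 := by
          refine Finset.sum_congr rfl fun y _ => ?_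
          have h0 : K.G *ᵥ y = 0 ↔ y = 0 :=
            ⟨fun h => K.mulVec_injective (by simpa using h), fun h => by simp [h]⟩
          rw [sum_univ_sign]
          by_cases hy : y = 0
          · simp [hy]
          · rw [if_neg hy, if_neg (mt h0.1 hy), mul_zero]
      _ = 2 ^ n := by simp [hs]
  have hcount' : ((Finset.univ.filter fun v' => K.SamePhaseSyndrome f v v').card : ℝ) *
      2 ^ (k - m) = 2 ^ n := by exact_mod_cast hcount
  have hpow : (2 : ℝ) ^ (k - m) = 2 ^ k / 2 ^ m := by
    rw [eq_div_iff (by positivity), ← pow_add, Nat.sub_add_cancel hf.le]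
  rw [← hpow, ← mul_div_assoc, hcount', div_self (by positivity)]

/-- The operator of the decoder for bit flip syndrome `e` and a phase error `v` of the observed
phase syndrome: undo the estimated error and the encoding. -/
def decoderOp (f : Bits k → Bits m) (d : Bits n → Bits n → Bits n) (j : Bits (n - k) × Bits n) :
    Matrix (Bits m) (Bits n) ℂ :=
  (K.encoder f)ᴴ * (pauliX (K.uHat j.1) * pauliZ (d (K.uHat j.1) j.2))ᴴ

/-- Measure both syndromes, undo the error estimated from them by `K.uHat` and `d`, and invert the
encoding. -/
def decoder (f : Bits k → Bits m) (d : Bits n → Bits n → Bits n) :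
    Matrix (Bits n) (Bits n) ℂ →ₗ[ℂ] Matrix (Bits m) (Bits m) ℂ :=
  krausMap (fun _ => 2 ^ k / 2 ^ m / 2 ^ n) (K.decoderOp f d)

lemma sum_decoderOp (hf : IsFullRankAffine f) {d : Bits n → Bits n → Bits n}
    (hd : ∀ u v, K.SamePhaseSyndrome f (d u v) v) :
    ∑ j, ((2 ^ k / 2 ^ m / 2 ^ n : ℝ) : ℂ) • ((K.decoderOp f d j)ᴴ * K.decoderOp f d j) = 1 := by
  classical
  -- On `C'` the estimate `d` has the same signs as `j.2`, so the entry no longer depends on `d`.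
  -- Summing over `j.2` then gives a full character sum, which vanishes off the diagonal.
  have hop (j : Bits (n - k) × Bits n) (x x' : Bits n) :
      ((K.decoderOp f d j)ᴴ * K.decoderOp f d j) x x' =
        if K.H *ᵥ x = j.1 ∧ x + x' ∈ K.cosetSet f (f 0) then
          sign (x + x') j.2 * (2 ^ m / 2 ^ k) else 0 := by
    have h1 : (K.decoderOp f d j)ᴴ * K.decoderOp f d j =
        (pauliX (K.uHat j.1) * pauliZ (d (K.uHat j.1) j.2)) *
          (K.encoder f * (K.encoder f)ᴴ) *
          (pauliX (K.uHat j.1) * pauliZ (d (K.uHat j.1) j.2))ᴴ := by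
      simp only [decoderOp, Matrix.conjTranspose_mul, Matrix.conjTranspose_conjTranspose,
        Matrix.mul_assoc]
    have h2 : x + K.uHat j.1 + (x' + K.uHat j.1) = x + x' := by
      rw [add_add_add_comm, bits_add_self, add_zero]
    rw [h1, pauli_mul_mul_conjTranspose_apply, K.encoder_mul_conjTranspose_apply hf, h2,
      Matrix.mulVec_add, K.syndrome_uHat]
    simp only [bits_add_eq_zero, mul_ite, mul_zero]
    split_ifs with h
    · obtain ⟨-, y, hy, hfy⟩ := h
      rw [hy, hd _ _ y hfy]
    · rfl
  ext x x'
  rw [Matrix.sum_apply]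
  simp only [Matrix.smul_apply, hop, Fintype.sum_prod_type, smul_eq_mul, mul_ite, mul_zero,
    ite_and]
  rw [Finset.sum_comm]
  simp only [Finset.sum_ite_eq, Finset.mem_univ, if_true, Matrix.one_apply]
  by_cases hxx : x = x'
  · have h0 : (0 : Bits n) ∈ K.cosetSet f (f 0) := ⟨0, by simp, rfl⟩
    simp only [hxx, bits_add_self, h0, if_true, sign_zero_left, one_mul, Finset.sum_const]
    simp
    field_simp
  · rw [if_neg hxx]
    split_ifs with hc
    · simp only [sign_comm (x + x')]
      rw [← Finset.mul_sum, ← Finset.sum_mul, sum_univ_sign, if_neg (mt bits_add_eq_zero.1 hxx)]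
      simp
    · simp

/-- The code for `f` that is decoded by the phase error estimate `d`. -/
def pcssCode (hf : IsFullRankAffine f) (d : Bits n → Bits n → Bits n)
    (hd : ∀ u v, K.SamePhaseSyndrome f (d u v) v) : EntGenCode n m where
  encoder := K.encoder f
  isometry := K.encoder_isometry hf
  decoder := K.decoder f d
  isQuantumOperation := isQuantumOperation_krausMap (fun _ => by positivity)
    (K.sum_decoderOp hf hd)

lemma isPCSS_pcssCode (hf : IsFullRankAffine f) {d : Bits n → Bits n → Bits n}
    (hd : ∀ u v, K.SamePhaseSyndrome f (d u v) v) : (K.pcssCode hf d hd).IsPCSS K f where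
  encoder_eq _ _ := rfl
  stabilized := K.mem_range_encoder_iff hf

/-- The bit flips cancel and leave `Z^{d+v}`. The estimate need not equal `v`: agreement of the
signs on `C` suffices. -/
lemma decoderOp_mul_pauli_mul_encoder (hf : IsFullRankAffine f) {d : Bits n → Bits n → Bits n}
    {u v v' : Bits n} (hu : K.uHat (K.H *ᵥ u) = u) (hv : d u v' = d u v)
    (hdv : ∀ y, sign (K.G *ᵥ y) (d u v) = sign (K.G *ᵥ y) v) :
    K.decoderOp f d (K.H *ᵥ u, v') * (pauliX u * pauliZ v * K.encoder f) = 1 := by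
  rw [decoderOp]
  simp only [hu, hv]
  rw [Matrix.mul_assoc, ← Matrix.mul_assoc _ _ (K.encoder f), conjTranspose_pauli_mul_pauli,
    K.pauliZ_mul_encoder, K.encoder_isometry hf]
  intro y
  rw [sign_add_right, hdv, sign_mul_self]

open Classical in
/-- The error of the code is at most twice the probability of an incorrectly estimated error. -/
lemma error_pcssCode_le (N : PauliChannel n) (hf : IsFullRankAffine f)
    {d : Bits n → Bits n → Bits n} (hd : ∀ u v, K.SamePhaseSyndrome f (d u v) v)
    (hd' : ∀ u v v', K.SamePhaseSyndrome f v v' → d u v = d u v') :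
    (K.pcssCode hf d hd).error N ≤ 2 * ∑ u, ∑ v,
      if K.uHat (K.H *ᵥ u) = u ∧ ∀ y, sign (K.G *ᵥ y) (d u v) = sign (K.G *ᵥ y) v then 0
      else N.p u v := by
  have hcomp : (K.pcssCode hf d hd).decoder ∘ₗ N.toLinearMap ∘ₗ
      sandwich (K.pcssCode hf d hd).encoder (K.pcssCode hf d hd).encoderᴴ =
      krausMap (fun i : (Bits (n - k) × Bits n) × (Bits n × Bits n) =>
        2 ^ k / 2 ^ m / 2 ^ n * N.p i.2.1 i.2.2)
        fun i => K.decoderOp f d i.1 * (pauliX i.2.1 * pauliZ i.2.2 * K.encoder f) := by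
    rw [N.toLinearMap_eq_krausMap, krausMap_comp_sandwich]
    exact krausMap_comp _ _ _ _
  have htr (ρ : Matrix (Bits m) (Bits m) ℂ) :
      (((K.pcssCode hf d hd).decoder ∘ₗ N.toLinearMap ∘ₗ
      sandwich (K.pcssCode hf d hd).encoder (K.pcssCode hf d hd).encoderᴴ) ρ).trace =
        ρ.trace := by
    rw [LinearMap.comp_apply, LinearMap.comp_apply,
      (K.pcssCode hf d hd).isQuantumOperation.tracePreserving, N.trace_toLinearMap]
    change (K.encoder f * ρ * (K.encoder f)ᴴ).trace = _
    rw [Matrix.trace_mul_comm, ← Matrix.mul_assoc, K.encoder_isometry hf, Matrix.one_mul]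
  rw [EntGenCode.error]
  rw [hcomp] at htr ⊢
  refine traceNorm_idTensor_krausMap_sub_le (fun i => mul_nonneg (by positivity) (N.nonneg _ _))
    htr (Finset.univ.filter fun i => i.1.1 = K.H *ᵥ i.2.1 ∧ K.SamePhaseSyndrome f i.2.2 i.1.2 ∧
      K.uHat (K.H *ᵥ i.2.1) = i.2.1 ∧
        ∀ y, sign (K.G *ᵥ y) (d i.2.1 i.2.2) = sign (K.G *ᵥ y) i.2.2) ?_ ?_
    (ketbra_posSemidef _) (trace_ketbra_ebits m)
  · rintro ⟨⟨e, v'⟩, u, v⟩ hi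
    simp only [Finset.mem_filter, Finset.mem_univ, true_and] at hi
    obtain ⟨rfl, hv, hu, hdv⟩ := hi
    exact K.decoderOp_mul_pauli_mul_encoder hf hu (hd' u v v' hv).symm hdv
  · rw [Finset.sum_filter, Fintype.sum_prod_type_right, Fintype.sum_prod_type,
      ← N.sum_eq_one, ← Finset.sum_sub_distrib]
    refine Finset.sum_le_sum fun u _ => ?_
    rw [← Finset.sum_sub_distrib]
    refine Finset.sum_le_sum fun v _ => ?_
    by_cases hg : K.uHat (K.H *ᵥ u) = u ∧ ∀ y, sign (K.G *ᵥ y) (d u v) = sign (K.G *ᵥ y) v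
    -- For a correctly estimated `(u, v)`, the decoder outcomes in the class of `v` have total
    -- weight one, so all of `p_{u,v}` counts as good.
    · have hcard := K.sum_samePhaseSyndrome hf v
      simp only [hg, if_true, Fintype.sum_prod_type, ite_and]
      rw [Finset.sum_comm]
      simp only [implies_true, if_true, Finset.sum_ite_eq', Finset.mem_univ]
      rw [← Finset.sum_filter, Finset.sum_const, nsmul_eq_mul, ← mul_assoc, hcard]
      simp
    · rw [if_neg hg, sub_self]
      refine Finset.sum_nonneg fun j _ => ?_
      split_ifs
      · exact mul_nonneg (by positivity) (N.nonneg _ _)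
      · exact le_rfl

end ClassicalCode

/-! ### The states `ω^{XE}`, `ω^E` and their entropies. -/

namespace PauliChannel

variable {n : ℕ} (N : PauliChannel n)

/-- `B` holds `x + u`, so for fixed `x` tracing it out removes coherence between different `u`. -/
lemma omegaXE_apply (x x' : Bits n) (e e' : Bits n × Bits n) :
    N.omegaXE (x, e) (x', e') = if x = x' then if e.1 = e'.1 then
      1 / 2 ^ n * ((Real.sqrt (N.p e.1 e.2) : ℂ) * sign x e.2 *
        ((Real.sqrt (N.p e'.1 e'.2) : ℂ) * sign x e'.2)) else 0 else 0 := by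
  have h (y z : Bits n) : Matrix.kronecker (Matrix.single z z (1 : ℂ)) (ketbra (N.phi z))
      (x, y, e) (x', y, e') = if z = x then if x = x' then
        N.phi z (y, e) * star (N.phi z (y, e')) else 0 else 0 := by
    simp only [Matrix.kronecker, Matrix.kroneckerMap_apply, Matrix.single, Matrix.of_apply, ketbra,
      Matrix.vecMulVec_apply, Pi.star_apply]
    by_cases h1 : z = x
    · subst h1
      simp
    · simp [h1]
  simp only [omegaXE, traceMid, omega, Matrix.of_apply, Matrix.smul_apply, Matrix.sum_apply, h,
    Finset.sum_ite_eq', Finset.mem_univ, if_true]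
  by_cases hx : x = x'
  · simp only [hx, if_true, phi, ite_mul, zero_mul, Finset.sum_ite_eq',
      Finset.mem_univ, add_right_inj, apply_ite (star : ℂ → ℂ), star_zero, mul_ite, mul_zero,
      star_mul', RCLike.star_def, Complex.conj_ofReal, conj_sign, smul_eq_mul, eq_comm]
  · simp [hx]

/-- Averaging the signs over `x` removes coherence between different `v`. -/
lemma omegaE_eq_diagonal :
    N.omegaE = Matrix.diagonal fun e : Bits n × Bits n => (N.p e.1 e.2 : ℂ) := by
  ext ⟨u, v⟩ ⟨u', v'⟩
  simp only [omegaE, traceFst, Matrix.of_apply, omegaXE_apply, if_true]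
  rw [Matrix.diagonal_apply]
  by_cases hu : u = u'
  · subst hu
    simp only [if_true]
    have h (x : Bits n) : (1 / 2 ^ n * ((Real.sqrt (N.p u v) : ℂ) * sign x v *
        ((Real.sqrt (N.p u v') : ℂ) * sign x v')) : ℂ) =
        1 / 2 ^ n * ((Real.sqrt (N.p u v) : ℂ) * (Real.sqrt (N.p u v') : ℂ)) *
          sign x (v + v') := by
      rw [sign_add_right]
      ring
    simp only [h]
    rw [← Finset.mul_sum, sum_univ_sign]
    by_cases hv : v = v'
    · subst hv
      rw [if_pos (bits_add_self v), if_pos rfl, ← Complex.ofReal_mul,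
        Real.mul_self_sqrt (N.nonneg u v)]
      field_simp
    · rw [if_neg (mt bits_add_eq_zero.1 hv), if_neg (by simp [hv]), mul_zero]
  · simp [hu]

/-- The number of Pauli errors of positive probability with bit flip part `u`. -/
def phaseCount (u : Bits n) : ℕ := (Finset.univ.filter fun v => N.p u v ≠ 0).card

lemma rank_omegaE : N.omegaE.rank = ∑ u, N.phaseCount u := by
  rw [omegaE_eq_diagonal, Matrix.rank_diagonal, Fintype.card_subtype]
  simp only [Finset.card_filter, Fintype.sum_prod_type, phaseCount, ne_eq,
    Complex.ofReal_eq_zero]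

/-- Given `x` and `u`, the block on `v` is rank one with trace `2^{-n} p_u`; the `2^n` values of `x`
contribute equally. -/
lemma trace_omegaXE_sq : (N.omegaXE ^ 2).trace = ((1 / 2 ^ n * ∑ u, N.bitFlip u ^ 2 : ℝ) : ℂ) := by
  have hsq (u v : Bits n) : (Real.sqrt (N.p u v) : ℂ) * (Real.sqrt (N.p u v) : ℂ) = N.p u v := by
    rw [← Complex.ofReal_mul, Real.mul_self_sqrt (N.nonneg u v)]
  have hterm (x u v v' : Bits n) : (1 / 2 ^ n * ((Real.sqrt (N.p u v) : ℂ) * sign x v *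
        ((Real.sqrt (N.p u v') : ℂ) * sign x v')) : ℂ) * (1 / 2 ^ n *
        ((Real.sqrt (N.p u v') : ℂ) * sign x v' * ((Real.sqrt (N.p u v) : ℂ) * sign x v))) =
        1 / 2 ^ n * (1 / 2 ^ n) * (N.p u v * N.p u v') := by
    rw [← hsq u v, ← hsq u v']
    have h1 := sign_mul_self x v
    have h2 := sign_mul_self x v'
    generalize sign x v = a at *
    generalize sign x v' = b at *
    generalize (Real.sqrt (N.p u v) : ℂ) = c
    generalize (Real.sqrt (N.p u v') : ℂ) = d
    linear_combination (1 / 2 ^ n * (1 / 2 ^ n) * (c * c * (d * d))) * (b * b * h1 + h2)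
  have hentry (x u v x' u' v' : Bits n) :
      N.omegaXE (x, u, v) (x', u', v') * N.omegaXE (x', u', v') (x, u, v) =
      if x = x' then if u = u' then 1 / 2 ^ n * (1 / 2 ^ n) * ((N.p u v : ℂ) * N.p u v')
        else 0 else 0 := by
    simp only [omegaXE_apply]
    by_cases hx : x = x'
    · by_cases hu : u = u'
      · subst hx hu
        simp only [if_true, hterm]
      · simp [hu]
    · simp [hx]
  rw [sq]
  simp only [Matrix.trace, Matrix.diag, Matrix.mul_apply, Fintype.sum_prod_type, hentry]
  have h (x : Bits n) : (∑ u, ∑ v, ∑ x', ∑ u', ∑ v', if x = x' then if u = u' then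
      1 / 2 ^ n * (1 / 2 ^ n) * ((N.p u v : ℂ) * N.p u v') else 0 else 0) =
      1 / 2 ^ n * (1 / 2 ^ n) * ∑ u, (N.bitFlip u : ℂ) ^ 2 := by
    rw [Finset.mul_sum]
    refine Finset.sum_congr rfl fun u _ => ?_
    simp only [Finset.sum_ite_irrel, Finset.sum_const_zero, Finset.sum_ite_eq, Finset.mem_univ,
      if_true]
    rw [bitFlip, Complex.ofReal_sum, sq, Finset.sum_mul_sum, Finset.mul_sum]
    simp only [Finset.mul_sum]
  simp only [h, Finset.sum_const, Finset.card_univ, Fintype.card_pi, ZMod.card, Finset.prod_const,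
    Fintype.card_fin, nsmul_eq_mul]
  push_cast
  field_simp

lemma bitFlip_nonneg (u : Bits n) : 0 ≤ N.bitFlip u :=
  Finset.sum_nonneg fun v _ => N.nonneg u v

lemma sum_bitFlip : ∑ u, N.bitFlip u = 1 := N.sum_eq_one

lemma exists_pos : ∃ u v, 0 < N.p u v := by
  by_contra! h
  have : ∑ u, ∑ v, N.p u v ≤ 0 :=
    Finset.sum_nonpos fun u _ => Finset.sum_nonpos fun v _ => h u v
  rw [N.sum_eq_one] at this
  linarith

lemma privacyError_eq (k m : ℕ) : privacyError N k m =
    Real.sqrt ((∑ u, N.bitFlip u ^ 2) * ∑ u, (2 ^ m / 2 ^ k) * (N.phaseCount u : ℝ)) := by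
  -- A Pauli error of positive probability makes the arguments of both logarithms positive.
  obtain ⟨u₀, v₀, h₀⟩ := N.exists_pos
  set B := ∑ u, N.bitFlip u ^ 2 with hB
  have hBpos : 0 < B := by
    have h1 : 0 < N.bitFlip u₀ :=
      h₀.trans_le (Finset.single_le_sum (fun v _ => N.nonneg u₀ v) (Finset.mem_univ v₀))
    exact (pow_pos h1 2).trans_le
      (Finset.single_le_sum (f := fun u => N.bitFlip u ^ 2) (fun u _ => sq_nonneg _)
        (Finset.mem_univ u₀))
  set S : ℝ := ∑ u, (N.phaseCount u : ℝ) with hS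
  have hSpos : 0 < S := by
    have h1 : 0 < N.phaseCount u₀ := Finset.card_pos.2 ⟨v₀, by simp [h₀.ne']⟩
    have h2 : (0 : ℝ) < N.phaseCount u₀ := by exact_mod_cast h1
    exact h2.trans_le (Finset.single_le_sum (f := fun u => (N.phaseCount u : ℝ))
      (fun u _ => Nat.cast_nonneg _) (Finset.mem_univ u₀))
  have hpow (j : ℕ) : Real.logb 2 (2 ^ j) = j := by
    rw [Real.logb_pow, Real.logb_self_eq_one (by norm_num), mul_one]
  have hlog : Real.logb 2 (B * (2 ^ m / 2 ^ k * S)) =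
      Real.logb 2 B + (m - k + Real.logb 2 S) := by
    rw [Real.logb_mul hBpos.ne' (by positivity), Real.logb_mul (by positivity) hSpos.ne',
      Real.logb_div (by positivity) (by positivity), hpow, hpow]
  rw [← Finset.mul_sum, ← hS, Real.sqrt_eq_rpow, privacyError, renyiTwo, renyiZero, rank_omegaE,
    trace_omegaXE_sq, Complex.ofReal_re, ← hB, Real.logb_mul (by positivity) hBpos.ne',
    one_div (2 ^ n : ℝ), Real.logb_inv, hpow]
  push_cast
  rw [← hS]
  rw [← Real.rpow_logb (b := 2) (by norm_num) (by norm_num)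
    (show 0 < B * (2 ^ m / 2 ^ k * S) by positivity)]
  rw [← Real.rpow_mul (by norm_num), hlog]
  congr 1
  ring

end PauliChannel

/-! ### Probabilities of wrong bit-flip and phase estimates. -/

namespace ClassicalCode

variable {n k m : ℕ} (K : ClassicalCode n k) (N : PauliChannel n)

/-- Multiplying by `p_e` cancels the conditioning, leaving the probability that `û(Hu) ≠ u`. If `p_e
= 0`, every `p_u` in the fibre vanishes too. -/
lemma avgError_eq :
    K.avgError N = ∑ u, if K.uHat (K.H *ᵥ u) = u then 0 else N.bitFlip u := by
  rw [avgError, ← Finset.sum_fiberwise (s := Finset.univ) (g := fun u => K.H *ᵥ u)]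
  refine Finset.sum_congr rfl fun e _ => ?_
  have hle : N.bitFlip (K.uHat e) ≤ K.syndromeProb N e :=
    Finset.single_le_sum (fun u _ => N.bitFlip_nonneg u) (by simp [K.syndrome_uHat])
  have h1 : K.syndromeProb N e * (1 - K.condProb N (K.uHat e) e) =
      K.syndromeProb N e - N.bitFlip (K.uHat e) := by
    rw [condProb, if_pos (K.syndrome_uHat e), one_mul]
    by_cases h0 : K.syndromeProb N e = 0
    · rw [h0] at hle
      rw [h0, le_antisymm hle (N.bitFlip_nonneg _)]
      simp
    · field_simp
  have h2 : N.bitFlip (K.uHat e) =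
      ∑ u with K.H *ᵥ u = e, if K.uHat e = u then N.bitFlip u else 0 := by
    rw [Finset.sum_ite_eq, if_pos (by simp [K.syndrome_uHat])]
  rw [h1, h2, syndromeProb, ← Finset.sum_sub_distrib]
  refine Finset.sum_congr rfl fun u hu => ?_
  rw [(Finset.mem_filter.1 hu).2]
  split_ifs <;> simp

lemma avgError_nonneg : 0 ≤ K.avgError N := by
  rw [avgError_eq]
  refine Finset.sum_nonneg fun u _ => ?_
  split_ifs
  exacts [le_rfl, N.bitFlip_nonneg u]

lemma avgError_le_one : K.avgError N ≤ 1 := by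
  rw [avgError_eq, ← N.sum_bitFlip]
  refine Finset.sum_le_sum fun u _ => ?_
  split_ifs
  exacts [N.bitFlip_nonneg u, le_rfl]

/-- A phase error estimate from the phase syndrome that picks a possible phase error whenever there
is one. -/
lemma exists_phaseEstimate (f : Bits k → Bits m) : ∃ d : Bits n → Bits n → Bits n,
    (∀ u v, K.SamePhaseSyndrome f (d u v) v) ∧
    (∀ u v v', K.SamePhaseSyndrome f v v' → d u v = d u v') ∧
    ∀ u v, N.p u v ≠ 0 → N.p u (d u v) ≠ 0 := by
  let S : Setoid (Bits n) :=
    { r := K.SamePhaseSyndrome f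
      iseqv := ⟨fun _ _ _ => rfl, fun h y hy => (h y hy).symm,
        fun h h' y hy => (h y hy).trans (h' y hy)⟩ }
  have h (u : Bits n) (c : Quotient S) : ∃ w, Quotient.mk S w = c ∧
      ∀ v, Quotient.mk S v = c → N.p u v ≠ 0 → N.p u w ≠ 0 := by
    by_cases hc : ∃ w, Quotient.mk S w = c ∧ N.p u w ≠ 0
    · obtain ⟨w, hw, hp⟩ := hc
      exact ⟨w, hw, fun _ _ _ => hp⟩
    · obtain ⟨w, hw⟩ := Quotient.exists_rep c
      exact ⟨w, hw, fun v hv hp => absurd ⟨v, hv, hp⟩ hc⟩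
  choose g hg hp using h
  exact ⟨fun u v => g u (Quotient.mk S v), fun u v => Quotient.exact (hg u _),
    fun u v v' hv => congrArg (g u) (Quotient.sound hv), fun u v => hp u _ v rfl⟩

open Classical in
/-- Averaged over a two-universal function, a phase error is estimated incorrectly with probability
at most `2 · 2^{m-k}` times the number of possible phase errors. -/
lemma sum_wrong_phaseEstimate_le {P : PMF (Bits k → Bits m)} (hP : IsTwoUniversal P)
    (hA : ∀ f ∈ P.support, IsFullRankAffine f)
    {d : (Bits k → Bits m) → Bits n → Bits n → Bits n}
    (hd : ∀ f u v, K.SamePhaseSyndrome f (d f u v) v)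
    (hd' : ∀ f u v, N.p u v ≠ 0 → N.p u (d f u v) ≠ 0) {u v : Bits n} (huv : N.p u v ≠ 0) :
    ∑ f with ¬ ∀ y, sign (K.G *ᵥ y) (d f u v) = sign (K.G *ᵥ y) v, (P f).toReal ≤
      2 * (2 ^ m / 2 ^ k * (N.phaseCount u : ℝ)) := by
  have hiff (y : Bits k) (v' : Bits n) : sign y (K.Gᵀ *ᵥ (v' + v)) = 1 ↔
      sign (K.G *ᵥ y) v' = sign (K.G *ᵥ y) v := by
    rw [← sign_mulVec, sign_add_right]
    constructor
    · intro h
      linear_combination sign (K.G *ᵥ y) v * h - sign (K.G *ᵥ y) v' * sign_mul_self (K.G *ᵥ y) v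
    · intro h
      rw [h, sign_mul_self]
  -- The possible phase errors that act differently from `v` on `C`. A wrong estimate lies in `W`
  -- and shares the syndrome of `v`, so a union bound over `W` applies.
  set W := Finset.univ.filter fun v' => N.p u v' ≠ 0 ∧ K.Gᵀ *ᵥ (v' + v) ≠ 0 with hW
  have hWcard : W.card ≤ N.phaseCount u :=
    Finset.card_le_card fun v' hv' => by
      rw [hW, Finset.mem_filter] at hv'
      exact Finset.mem_filter.2 ⟨Finset.mem_univ _, hv'.2.1⟩
  calc ∑ f with ¬ ∀ y, sign (K.G *ᵥ y) (d f u v) = sign (K.G *ᵥ y) v, (P f).toReal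
      ≤ ∑ f, ∑ v' ∈ W,
        if ∀ y, f y = f 0 → sign y (K.Gᵀ *ᵥ (v' + v)) = 1 then (P f).toReal else 0 := by
        rw [Finset.sum_filter]
        refine Finset.sum_le_sum fun f _ => ?_
        have hnn : ∀ v' ∈ W, 0 ≤ if ∀ y, f y = f 0 → sign y (K.Gᵀ *ᵥ (v' + v)) = 1 then
            (P f).toReal else 0 := fun v' _ => by
          split_ifs
          exacts [ENNReal.toReal_nonneg, le_rfl]
        split_ifs with h
        · exact Finset.sum_nonneg hnn
        · have hmem : d f u v ∈ W := by
            refine Finset.mem_filter.2 ⟨Finset.mem_univ _, hd' f u v huv, fun h0 => h fun y => ?_⟩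
            rw [← hiff, h0, sign_zero_right]
          refine le_trans ?_ (Finset.single_le_sum hnn hmem)
          rw [if_pos fun y hy => (hiff y _).2 (hd f u v y hy)]
    _ = ∑ v' ∈ W, ∑ f with ∀ y, f y = f 0 → sign y (K.Gᵀ *ᵥ (v' + v)) = 1, (P f).toReal := by
        rw [Finset.sum_comm]
        simp only [Finset.sum_filter]
    _ ≤ ∑ _v' ∈ W, 2 * (2 ^ m / 2 ^ k) := Finset.sum_le_sum fun v' hv' =>
        hP.sum_annihilator_le hA (Finset.mem_filter.1 hv').2.2
    _ = W.card * (2 * (2 ^ m / 2 ^ k)) := by rw [Finset.sum_const, nsmul_eq_mul]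
    _ ≤ N.phaseCount u * (2 * (2 ^ m / 2 ^ k)) := by gcongr
    _ = _ := by ring

end ClassicalCode

end PCSS

end

/-! ### Averaging over `f` and the final estimate. -/

theorem theorem1 {n k m : ℕ} (N : PCSS.PauliChannel n) (K : PCSS.ClassicalCode n k)
    (P : PMF (PCSS.Bits k → PCSS.Bits m))
    (hAffine : ∀ f ∈ P.support, PCSS.IsFullRankAffine f)
    (hUniversal : PCSS.IsTwoUniversal P) :
    ∃ Q : (PCSS.Bits k → PCSS.Bits m) → PCSS.EntGenCode n m,
      (∀ f ∈ P.support, (Q f).IsPCSS K f) ∧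
      PCSS.IsGoodOnAverage P Q N
        (2 * Real.sqrt (2 * PCSS.privacyError N k m + 4 * Real.sqrt (2 * K.avgError N))
          + 2 * Real.sqrt (2 * K.avgError N)) := by
  classical
  choose d hd hd' hdp using fun f : PCSS.Bits k → PCSS.Bits m => K.exists_phaseEstimate N f
  obtain ⟨f₀, hf₀⟩ := P.support_nonempty
  -- Off the support of `P` any code will do, as it carries no weight; the code of `f₀` is used.
  let Q : (PCSS.Bits k → PCSS.Bits m) → PCSS.EntGenCode n m := fun f =>
    if hf : f ∈ P.support then K.pcssCode (hAffine f hf) (d f) (hd f)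
    else K.pcssCode (hAffine f₀ hf₀) (d f₀) (hd f₀)
  have hQ (f) (hf : f ∈ P.support) : Q f = K.pcssCode (hAffine f hf) (d f) (hd f) := dif_pos hf
  refine ⟨Q, fun f hf => hQ f hf ▸ K.isPCSS_pcssCode (hAffine f hf) (hd f), ?_⟩
  set ε := K.avgError N with hε
  set T : PCSS.Bits n → PCSS.Bits n → ℝ := fun u v =>
    ∑ f with ¬ ∀ y, PCSS.sign (K.G.mulVec y) (d f u v) = PCSS.sign (K.G.mulVec y) v, (P f).toReal
    with hT
  set t := ∑ u, ∑ v, N.p u v * T u v with ht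
  have hsum := PCSS.sum_pmf_toReal P
  have hT0 (u v) : 0 ≤ T u v := Finset.sum_nonneg fun _ _ => ENNReal.toReal_nonneg
  have hT1 (u v) : T u v ≤ 1 := by
    rw [← hsum]
    exact Finset.sum_le_sum_of_subset_of_nonneg (Finset.filter_subset _ _)
      fun _ _ _ => ENNReal.toReal_nonneg
  have ht0 : 0 ≤ t := Finset.sum_nonneg fun u _ => Finset.sum_nonneg fun v _ =>
    mul_nonneg (N.nonneg u v) (hT0 u v)
  have ht1 : t ≤ 1 := by
    rw [← N.sum_eq_one]
    exact Finset.sum_le_sum fun u _ => Finset.sum_le_sum fun v _ =>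
      mul_le_of_le_one_right (N.nonneg u v) (hT1 u v)
  have herr (f) (hf : f ∈ P.support) : (Q f).error N ≤ 2 * (ε + ∑ u, ∑ v, N.p u v *
      if ∀ y, PCSS.sign (K.G.mulVec y) (d f u v) = PCSS.sign (K.G.mulVec y) v then 0 else 1) := by
    rw [hQ f hf]
    refine (K.error_pcssCode_le N (hAffine f hf) (hd f) (hd' f)).trans ?_
    gcongr
    rw [hε, K.avgError_eq, ← Finset.sum_add_distrib]
    refine Finset.sum_le_sum fun u _ => ?_
    have hb : (if K.uHat (K.H.mulVec u) = u then 0 else N.bitFlip u) =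
        ∑ v, if K.uHat (K.H.mulVec u) = u then 0 else N.p u v := by
      rw [Finset.sum_ite_irrel, Finset.sum_const_zero]
      rfl
    rw [hb, ← Finset.sum_add_distrib]
    refine Finset.sum_le_sum fun v _ => ?_
    have := N.nonneg u v
    by_cases h1 : K.uHat (K.H.mulVec u) = u <;>
    by_cases h2 : ∀ y, PCSS.sign (K.G.mulVec y) (d f u v) = PCSS.sign (K.G.mulVec y) v <;>
    simp [h1, h2, this]
  have havg : ∑ f, (P f).toReal * (Q f).error N ≤ 2 * (ε + t) := by
    calc ∑ f, (P f).toReal * (Q f).error N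
        ≤ ∑ f, (P f).toReal * (2 * (ε + ∑ u, ∑ v, N.p u v *
          if ∀ y, PCSS.sign (K.G.mulVec y) (d f u v) = PCSS.sign (K.G.mulVec y) v
            then 0 else 1)) := by
          refine Finset.sum_le_sum fun f _ => ?_
          by_cases hf : f ∈ P.support
          · exact mul_le_mul_of_nonneg_left (herr f hf) ENNReal.toReal_nonneg
          · simp [(PMF.apply_eq_zero_iff P f).2 hf]
      _ = 2 * (ε * ∑ f, (P f).toReal + ∑ f, ∑ u, ∑ v, N.p u v *
          if ∀ y, PCSS.sign (K.G.mulVec y) (d f u v) = PCSS.sign (K.G.mulVec y) v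
            then 0 else (P f).toReal) := by
          rw [Finset.mul_sum, ← Finset.sum_add_distrib, Finset.mul_sum]
          refine Finset.sum_congr rfl fun f _ => ?_
          rw [mul_left_comm, mul_add, mul_comm ε]
          simp only [mul_ite, mul_zero, mul_one, mul_comm (P f).toReal, Finset.sum_mul, ite_mul,
            zero_mul]
      _ = 2 * (ε + t) := by
          rw [hsum, mul_one, Finset.sum_comm, ht]
          congr 2
          refine Finset.sum_congr rfl fun u _ => ?_
          rw [Finset.sum_comm]
          refine Finset.sum_congr rfl fun v _ => ?_
          simp only [hT, ← Finset.mul_sum, Finset.sum_filter, ite_not]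
  have htε : t ≤ Real.sqrt 2 * PCSS.privacyError N k m := by
    -- From `T ≤ 1` one gets `T² ≤ T`, so a linear bound on `T` passes to its square root, the form
    -- that Cauchy–Schwarz needs.
    have hterm (u v) : N.p u v * T u v ≤
        N.p u v * Real.sqrt (2 * (2 ^ m / 2 ^ k * (N.phaseCount u : ℝ))) := by
      by_cases hp : N.p u v = 0
      · simp [hp]
      · refine mul_le_mul_of_nonneg_left (Real.le_sqrt_of_sq_le ?_) (N.nonneg u v)
        refine le_trans ?_ (K.sum_wrong_phaseEstimate_le N hUniversal hAffine hd hdp hp)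
        rw [sq]
        exact mul_le_of_le_one_left (hT0 u v) (hT1 u v)
    calc t ≤ ∑ u, ∑ v, N.p u v * Real.sqrt (2 * (2 ^ m / 2 ^ k * (N.phaseCount u : ℝ))) :=
          Finset.sum_le_sum fun u _ => Finset.sum_le_sum fun v _ => hterm u v
      _ = Real.sqrt 2 * ∑ u, N.bitFlip u * Real.sqrt (2 ^ m / 2 ^ k * (N.phaseCount u : ℝ)) := by
          rw [Finset.mul_sum]
          refine Finset.sum_congr rfl fun u _ => ?_
          rw [← Finset.sum_mul, Real.sqrt_mul (by norm_num), mul_left_comm]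
          rfl
      _ ≤ Real.sqrt 2 * PCSS.privacyError N k m := by
          rw [N.privacyError_eq]
          refine mul_le_mul_of_nonneg_left ?_ (Real.sqrt_nonneg 2)
          refine (Real.sum_mul_le_sqrt_mul_sqrt _ _ _).trans_eq ?_
          rw [← Real.sqrt_mul (Finset.sum_nonneg fun u _ => sq_nonneg _)]
          congr 2
          exact Finset.sum_congr rfl fun u _ => Real.sq_sqrt (by positivity)
  have hε0 : 0 ≤ ε := K.avgError_nonneg N
  have hε1 : ε ≤ 1 := K.avgError_le_one N
  have hpriv : 0 ≤ PCSS.privacyError N k m := by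
    rw [N.privacyError_eq]
    exact Real.sqrt_nonneg _
  have hsqrt2 : Real.sqrt 2 ≤ 2 := Real.sqrt_le_iff.2 (by norm_num)
  -- The remaining slack: `ε² ≤ ε ≤ 2ε` and `t² ≤ t ≤ √2 ε' ≤ 2ε'`; the term `4√(2ε)` is only needed
  -- to be nonnegative.
  have hb1 : ε ≤ Real.sqrt (2 * ε) := Real.le_sqrt_of_sq_le (by nlinarith)
  have hb2 : t ≤ Real.sqrt (2 * PCSS.privacyError N k m + 4 * Real.sqrt (2 * ε)) := by
    refine Real.le_sqrt_of_sq_le ?_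
    have h1 : t ^ 2 ≤ t := by nlinarith
    have h2 := mul_le_mul_of_nonneg_right hsqrt2 hpriv
    have h3 := Real.sqrt_nonneg (2 * ε)
    linarith
  refine havg.trans ?_
  linarith
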